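/- Let $\mathbb S^{d-1}$ and $\mathbb B^d$ be the unit sphere and the closed unit ball of $\mathbb R^d$, $d\ge 1$. In the ridge bandit with link function $f$ on $[-1,1]$ and unknown parameter $\theta^\star\in\mathbb S^{d-1}$, at each round $t=1,2,\dots$ the learner chooses (possibly at random) an action $a_t\in\mathbb B^d$ based on the history $\mathcal H_{t-1}=(a_s,r_s)_{s<t}$ and observes $r_t=f(\langle\theta^\star,a_t\rangle)+z_t$ with independent $z_t\sim\mathcal N(0,1)$. For $\varepsilon>0$ let $$T^\star(f,d,\varepsilon)=\min\Big\{T:\ \inf\sup_{\theta^\star\in\mathbb S^{d-1}}\mathbb E_{\theta^\star}\big[1-\langle\widehat\theta_T,\theta^\star\rangle\big]\le\varepsilon\Big\}\in\mathbb N\cup\{\infty\},$$ where the infimum is over all learners and all estimators $\widehat\theta_T=\widehat\theta_T(\mathcal H_T)\in\mathbb S^{d-1}$; if $f$ is even, $\langle\widehat\theta_T,\theta^\star\rangle$ is replaced by $|\langle\widehat\theta_T,\theta^\star\rangle|$. Let $$\mathfrak R_T^\star(f,d)=\inf\sup_{\theta^\star\in\mathbb S^{d-1}}\mathbb E_{\theta^\star}\Big[T\max_{a\in\mathbb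 B^d}f(\langle\theta^\star,a\rangle)-\sum_{t=1}^T f(\langle\theta^\star,a_t\rangle)\Big],$$ where the infimum is over all learners. Assume: 1. $f(0)=0$, $f(1)=1$, $|f|\le 1$ on $[-1,1]$, and either $f$ is non-decreasing on $[-1,1]$, or $f$ is even and non-decreasing on $[0,1]$. 2. $f$ is differentiable on $[0.1,1]$ (one-sidedly at the end points) and $c_f\le f'(x)\le C_f$ for all $x\in[0.1,1]$, with $c_f>0$. For $c>0$ define the burn-in integral $$I_c(f,d)=d^2\int_{\sqrt{c/d}}^{1/2}\frac{\mathrm d(x^2)}{\max_{\sqrt{c/d}\le y\le x}\ \min_{z\in[y/2,y]}[f'(z)]^2}\in[0,\infty],$$ where max and min are read as sup and inf, $1/0=\infty$, the integral is $0$ if $\sqrt{c/d}\ge 1/2$, and $f'(z)$ is read as $0$ if $f$ is not differentiable at $z$. Then there are absolute constants $c,K>0$ and $p\in\mathbb N$, independent of $(f,d,c_f,C_f,\varepsilon,T)$, such that for all such $f$, all $d\ge 1$, all $\varepsilon\in(0,1/2)$ and all integers $T\ge 0$, $$T^\star(f,d,\varepsilon)\le K\log^p(2+d+1/\varepsilon)\cdot\Big(I_c(f,d)+\frac{d^2}{c_f^2\,\varepsilon}\Big),$$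 $$\mathfrak R_T^\star(f,d)\le K\log^p(2+d+T)\cdot\min\Big\{I_c(f,d)+\frac{C_f}{c_f}\,d\sqrt T,\ T\Big\}.$$ -/

import Mathlib

open MeasureTheory ProbabilityTheory Set
open scoped ENNReal

namespace RidgeBandit

/-- The action set: the closed unit ball of `ℝ^d` with its Euclidean norm. -/
abbrev Action (d : ℕ) : Type :=
  Metric.closedBall (0 : EuclideanSpace ℝ (Fin d)) 1

/-- The parameter set: the unit sphere of `ℝ^d`. -/
abbrev Param (d : ℕ) : Type :=
  Metric.sphere (0 : EuclideanSpace ℝ (Fin d)) 1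

/-- A history of `t` rounds: the pairs (action, reward) of the rounds `0, …, t - 1`. -/
abbrev History (d t : ℕ) : Type := Fin t → Action d × ℝ

/-- A (possibly randomized) learner: after `t` rounds the next action is drawn from a
distribution that depends only on the observed history, measurably. -/
structure Policy (d : ℕ) where
  kernel : (t : ℕ) → Kernel (History d t) (Action d)
  isMarkov : ∀ t, IsMarkovKernel (kernel t)

/-- The mean reward `f(⟨θ, a⟩)` of the action `a` under the parameter `θ`. -/
noncomputable def meanReward {d : ℕ} (f : ℝ → ℝ) (θ : Param d) (a : Action d) : ℝ :=
  f (inner ℝ (θ : EuclideanSpace ℝ (Fin d)) (a : EuclideanSpace ℝ (Fin d)))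

/-- The law of the history of the first `t` rounds when `π` plays against the parameter `θ`:
in each round the action is drawn from `π` given the history, then an independent standard normal
noise `z` is drawn and the reward `f(⟨θ, a⟩) + z` is observed. -/
noncomputable def historyLaw {d : ℕ} (f : ℝ → ℝ) (θ : Param d) (π : Policy d) :
    (t : ℕ) → Measure (History d t)
  | 0 => Measure.dirac (fun i : Fin 0 => i.elim0)
  | t + 1 =>
      (((historyLaw f θ π t).compProd (π.kernel t)).prod (gaussianReal 0 1)).map
        (fun p : (History d t × Action d) × ℝ =>
          (Fin.snoc (α := fun _ : Fin (t + 1) => Action d × ℝ) p.1.1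
            (p.1.2, meanReward f θ p.1.2 + p.2) : History d (t + 1)))

/-- `f` is even on `[-1, 1]`. -/
def EvenLink (f : ℝ → ℝ) : Prop := ∀ x ∈ Icc (-1 : ℝ) 1, f (-x) = f x

open Classical in
/-- The estimation loss. It is `1 - ⟨u, θ⟩`, except that for an even link, where `θ` and `-θ`
produce the same observations, the correlation is taken up to the global sign. -/
noncomputable def estimationLoss {d : ℕ} (f : ℝ → ℝ) (u θ : Param d) : ℝ :=
  if EvenLink f then
    1 - |inner ℝ (u : EuclideanSpace ℝ (Fin d)) (θ : EuclideanSpace ℝ (Fin d))|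
  else
    1 - inner ℝ (u : EuclideanSpace ℝ (Fin d)) (θ : EuclideanSpace ℝ (Fin d))

/-- The minimax estimation risk after `T` rounds; the infimum is over the learners and over the
measurable estimators, which are functions of the history with values in the unit sphere. -/
noncomputable def minimaxRisk (f : ℝ → ℝ) (d T : ℕ) : ℝ≥0∞ :=
  ⨅ (π : Policy d) (est : History d T → Param d) (_ : Measurable est),
    ⨆ θ : Param d, ∫⁻ h, ENNReal.ofReal (estimationLoss f (est h) θ) ∂(historyLaw f θ π T)

/-- The sample complexity `T⋆(f, d, ε)`: the least `T` with minimax risk at most `ε`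
(`∞` if there is none). -/
noncomputable def sampleComplexity (f : ℝ → ℝ) (d : ℕ) (ε : ℝ) : ℝ≥0∞ :=
  ⨅ (T : ℕ) (_ : minimaxRisk f d T ≤ ENNReal.ofReal ε), (T : ℝ≥0∞)

/-- The regret of a realized history of `T` rounds. -/
noncomputable def pathRegret {d T : ℕ} (f : ℝ → ℝ) (θ : Param d) (h : History d T) : ℝ :=
  (T : ℝ) * (⨆ a : Action d, meanReward f θ a) - ∑ t : Fin T, meanReward f θ (h t).1

/-- The minimax regret over a horizon of `T` rounds. The regret of a history is nonnegative for
every bounded `f`, so its expectation is a lower Lebesgue integral. -/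
noncomputable def minimaxRegret (f : ℝ → ℝ) (d T : ℕ) : ℝ≥0∞ :=
  ⨅ π : Policy d, ⨆ θ : Param d,
    ∫⁻ h, ENNReal.ofReal (pathRegret f θ h) ∂(historyLaw f θ π T)

/-- The regularity conditions for the burn-in period, for a link function on `[-1, 1]`. -/
structure BurnInRegular (f : ℝ → ℝ) : Prop where
  zero : f 0 = 0
  one : f 1 = 1
  bounded : ∀ x ∈ Icc (-1 : ℝ) 1, |f x| ≤ 1
  monotone : MonotoneOn f (Icc (-1) 1) ∨ (EvenLink f ∧ MonotoneOn f (Icc 0 1))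

/-- The regularity conditions for the learning phase: on `[1/10, 1]` the link function is
differentiable (one-sidedly at the end points) with derivative between `cf` and `Cf`. -/
structure LearningRegular (f : ℝ → ℝ) (cf Cf : ℝ) : Prop where
  pos : 0 < cf
  differentiable : DifferentiableOn ℝ f (Icc (1 / 10) 1)
  lower : ∀ x ∈ Icc (1 / 10 : ℝ) 1, cf ≤ derivWithin f (Icc (1 / 10) 1) x
  upper : ∀ x ∈ Icc (1 / 10 : ℝ) 1, derivWithin f (Icc (1 / 10) 1) x ≤ Cf

/-- The best local signal `max_{b ≤ y ≤ x} min_{y/2 ≤ z ≤ y} f'(z)^2`. As `deriv` is `0` where `f`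
is not differentiable, a window `[y/2, y]` counts as `0` unless `f` is differentiable on it. -/
noncomputable def signal (f : ℝ → ℝ) (b x : ℝ) : ℝ≥0∞ :=
  ⨆ y ∈ Icc b x, ⨅ z ∈ Icc (y / 2) y, ENNReal.ofReal ((deriv f z) ^ 2)

/-- The burn-in integral `d^2 ∫ d(x^2) / signal(x)` over `√(c/d) ≤ x ≤ 1/2`, with
`d(x^2) = 2 x dx`. It is `0` on an empty range, and the integrand is `∞` where the signal is `0`. -/
noncomputable def burnInIntegral (f : ℝ → ℝ) (d : ℕ) (c : ℝ) : ℝ≥0∞ :=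
  (d : ℝ≥0∞) ^ 2 *
    ∫⁻ x in Icc (Real.sqrt (c / d)) (1 / 2),
      ENNReal.ofReal (2 * x) / signal f (Real.sqrt (c / d)) x

end RidgeBandit

/-! The learner climbs from the random-guess correlation `1/√d` to correlation `1/2` (burn-in,
`exists_burnIn`), and then runs a regression in the steep part of `f` (`exists_learn`).

Burn-in. A random sign vector has correlation between `1/(4√d)` and `4/√d` with a fixed vector of
length about one, with probability at least `1/50` (`err_signVector_le`). So logarithmically many
draws contain a good direction, provided that good directions can be recognized. Given a unit `a` of
correlation at least `x`, and a good `w` orthogonal to `a`, normalizing `x a + g w` gives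
correlation at least `√(x² + g²)` (`norm_improve_and_le_inner`). With `g² = 1/(256 d)` the squared
correlation grows by a fixed amount per step, so about `64 d` steps suffice.

To recognize `w`, compare the rewards of `λ a` and `λ a - μ w`, where `λ` brings the correlation
into a window `[y/2, y]`, `y ≤ x`, on which `f' ≥ s`. The correlation of `a` is known only from
below, so all `λ = (3/4)^(i+1)` are tried; the criterion `Separated` never accepts a bad `w`,
whatever `λ` is (`Separated.lt_sub`), and accepts a good one at the right scale. Arguments that
differ by order `1/√d` must be told apart, which takes about `d / s²` samples. With the best window
this is `d / signal`, and the sum over the levels, equally spaced in `x²`, is a Riemann sum below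
the burn-in integral (`sum_div_signal_le`).

Learning. From correlation `1/2`, the actions `a/2` and `a/2 + (3/20) eᵢ` keep the argument in
`[1/10, 1]`, where rewards determine arguments up to a factor `1/cf`. This gives every coordinate of
the parameter (`one_sub_inner_le_of_consistent`) with `d / (cf² ε)` samples, up to logarithms, for
each of `d + 1` actions.

For the regret, learning to accuracy `ε = d / (cf √T)` and then committing balances the two costs.
For an even link all of this is done with a vector `ϑ = ±θ` (`SameRewards`), whose sign is settled
by the first accepted direction.

Adaptive strategies are finite-depth trees `Prog` that branch on rewards rounded to a grid `1/N`.
Branching over `ℤ` makes measurability automatic, and `N` can be as large as needed because it costs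
no rounds. Coins are read off from the noise of the action `0`, so the learner itself is
deterministic. -/

namespace RidgeBandit

/-! ### Adaptive strategies as trees, and their expectations -/

/-- An interactive program: a tree that plays actions, branches on the rounded rewards, and
returns a value. -/
inductive Prog (d : ℕ) (α : Type) : Type
  | ret : α → Prog d α
  | play : Action d → (ℤ → Prog d α) → Prog d α

namespace Prog

variable {d : ℕ} {α β : Type}

/-- Sequential composition of programs. -/
def bind : Prog d α → (α → Prog d β) → Prog d β
  | ret x, q => q x
  | play a k, q => play a fun o => (k o).bind q

@[simp] lemma bind_ret (x : α) (q : α → Prog d β) : (ret x).bind q = q x := rfl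

@[simp] lemma bind_play (a : Action d) (k : ℤ → Prog d α) (q : α → Prog d β) :
    (play a k).bind q = play a fun o => (k o).bind q := rfl

/-- The law of the reward `x + z`, rounded down to a multiple of `1 / N`. -/
noncomputable def outcome (N x : ℝ) : Measure ℤ :=
  (gaussianReal x 1).map fun r => ⌊N * r⌋

lemma measurable_floor_mul (N : ℝ) : Measurable fun r : ℝ => ⌊N * r⌋ :=
  Int.measurable_floor.comp (measurable_const_mul N)

instance (N x : ℝ) : IsProbabilityMeasure (outcome N x) :=
  Measure.isProbabilityMeasure_map (measurable_floor_mul N).aemeasurable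

/-- The expectation of `Q` of the value returned by a program when the action `a` has mean reward
`m a`. -/
noncomputable def wp (N : ℝ) (m : Action d → ℝ) : Prog d α → (α → ℝ≥0∞) → ℝ≥0∞
  | ret x, Q => Q x
  | play a k, Q => ∫⁻ o, wp N m (k o) Q ∂(outcome N (m a))

variable {N : ℝ} {m : Action d → ℝ}

@[simp] lemma wp_ret (x : α) (Q : α → ℝ≥0∞) : wp N m (ret x) Q = Q x := rfl

lemma wp_play (a : Action d) (k : ℤ → Prog d α) (Q : α → ℝ≥0∞) :
    wp N m (play a k) Q = ∫⁻ o, wp N m (k o) Q ∂(outcome N (m a)) := rfl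

lemma wp_bind (p : Prog d α) (q : α → Prog d β) (Q : β → ℝ≥0∞) :
    wp N m (p.bind q) Q = wp N m p fun x => wp N m (q x) Q := by
  induction p with
  | ret x => rfl
  | play a k ih => simp only [bind_play, wp_play, ih]

lemma wp_mono (p : Prog d α) {Q R : α → ℝ≥0∞} (h : ∀ x, Q x ≤ R x) :
    wp N m p Q ≤ wp N m p R := by
  induction p with
  | ret x => exact h x
  | play a k ih => exact lintegral_mono fun o => ih o

lemma wp_add (p : Prog d α) (Q R : α → ℝ≥0∞) :
    wp N m p (fun x => Q x + R x) = wp N m p Q + wp N m p R := by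
  induction p with
  | ret x => rfl
  | play a k ih =>
    simp only [wp_play, ih]
    exact lintegral_add_left .of_discrete _

@[simp] lemma wp_const (p : Prog d α) (c : ℝ≥0∞) : wp N m p (fun _ => c) = c := by
  induction p with
  | ret x => rfl
  | play a k ih => simp only [wp_play, ih, lintegral_const, measure_univ, mul_one]

lemma wp_const_mul (p : Prog d α) (c : ℝ≥0∞) (Q : α → ℝ≥0∞) :
    wp N m p (fun x => c * Q x) = c * wp N m p Q := by
  induction p with
  | ret x => rfl
  | play a k ih =>
    simp only [wp_play, ih]
    exact lintegral_const_mul _ .of_discrete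

open Classical in
/-- The probability that the value returned by a program violates `G`. -/
noncomputable def err (N : ℝ) (m : Action d → ℝ) (p : Prog d α) (G : α → Prop) : ℝ≥0∞ :=
  wp N m p fun x => if G x then 0 else 1

lemma err_ret_of {x : α} {G : α → Prop} (h : G x) : err N m (ret x) G = 0 := by
  simp [err, h]

lemma err_le_one (p : Prog d α) (G : α → Prop) : err N m p G ≤ 1 := by
  classical
  refine (wp_mono p (R := fun _ => 1) fun x => ?_).trans_eq (wp_const p 1)
  split_ifs <;> simp

lemma err_mono (p : Prog d α) {G H : α → Prop} (h : ∀ x, G x → H x) :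
    err N m p H ≤ err N m p G := by
  classical
  refine wp_mono p fun x => ?_
  by_cases hG : G x
  · simp [hG, h x hG]
  · simp only [hG, if_false]; split_ifs <;> simp

lemma err_or_le (p : Prog d α) {G H K : α → Prop} (h : ∀ x, G x → H x → K x) :
    err N m p K ≤ err N m p G + err N m p H := by
  classical
  rw [err, err, err, ← wp_add]
  refine wp_mono p fun x => ?_
  by_cases hG : G x <;> by_cases hH : H x <;> by_cases hK : K x <;> simp [hG, hH, hK]
  exact hK (h x hG hH)

lemma wp_le_add_err (p : Prog d α) {G : α → Prop} {Q : α → ℝ≥0∞} {b B : ℝ≥0∞}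
    (h : ∀ x, G x → Q x ≤ b) (hB : ∀ x, Q x ≤ B) : wp N m p Q ≤ b + B * err N m p G := by
  classical
  rw [err, ← wp_const_mul]
  refine (wp_mono p (R := fun x => b + B * if G x then 0 else 1) fun x => ?_).trans_eq ?_
  · by_cases hG : G x
    · simpa [hG] using h x hG
    · simpa [hG] using (hB x).trans le_add_self
  · rw [wp_add, wp_const]

lemma err_bind_le (p : Prog d α) (q : α → Prog d β) {G : α → Prop} {H : β → Prop} {b : ℝ≥0∞}
    (h : ∀ x, G x → err N m (q x) H ≤ b) :
    err N m (p.bind q) H ≤ err N m p G + b := by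
  have := wp_le_add_err (N := N) (m := m) p (Q := fun x => err N m (q x) H) (B := 1) h
    fun x => err_le_one _ _
  rw [one_mul, add_comm] at this
  simpa only [err, wp_bind] using this

/-- A program plays at most `n` rounds, and only actions that satisfy `P`. -/
inductive Within (P : Action d → Prop) : ℕ → Prog d α → Prop
  | ret (n : ℕ) (x : α) : Within P n (ret x)
  | play {n : ℕ} {a : Action d} {k : ℤ → Prog d α} (ha : P a) (hk : ∀ o, Within P n (k o)) :
      Within P (n + 1) (play a k)

lemma Within.mono {P : Action d → Prop} {n n' : ℕ} {p : Prog d α} (h : Within P n p)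
    (hn : n ≤ n') : Within P n' p := by
  induction h generalizing n' with
  | ret n x => exact .ret _ _
  | play ha hk ih =>
    obtain ⟨k, rfl⟩ : ∃ k, n' = k + 1 := ⟨n' - 1, by omega⟩
    exact .play ha fun o => ih o (by omega)

lemma Within.bind {P : Action d → Prop} {n n' : ℕ} {p : Prog d α} {q : α → Prog d β}
    (h : Within P n p) (hq : ∀ x, Within P n' (q x)) : Within P (n + n') (p.bind q) := by
  induction h with
  | ret n x => exact (hq x).mono (by omega)
  | @play n a k ha hk ih =>
    have : n + 1 + n' = n + n' + 1 := by omega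
    rw [this]
    exact .play ha ih

/-! ### From programs to learners -/

/-- The next action of a program, where a value `x` that was returned leads to `c x`. -/
def next (c : α → Action d) : Prog d α → Action d
  | ret x => c x
  | play a _ => a

/-- The rest of a program after one round. -/
def advance : Prog d α → ℤ → Prog d α
  | ret x, _ => ret x
  | play _ k, o => k o

/-- The value returned by a program that has ended, or a default. -/
def result (x₀ : α) : Prog d α → α
  | ret x => x
  | play _ _ => x₀

/-- The rounded rewards of a history. -/
noncomputable def roundedRewards (N : ℝ) {t : ℕ} (h : History d t) : Fin t → ℤ :=
  fun i => ⌊N * (h i).2⌋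

lemma measurable_roundedRewards (N : ℝ) (t : ℕ) :
    Measurable (roundedRewards N : History d t → Fin t → ℤ) :=
  measurable_pi_lambda _ fun i =>
    (measurable_floor_mul N).comp (measurable_snd.comp (measurable_pi_apply i))

/-- The rest of a program after the rounds of a history. -/
noncomputable def after (N : ℝ) (p : Prog d α) {t : ℕ} (h : History d t) : Prog d α :=
  (List.ofFn (roundedRewards N h)).foldl advance p

lemma measurable_comp_after {X : Type} [MeasurableSpace X] (N : ℝ) (p : Prog d α) (t : ℕ)
    (F : Prog d α → X) : Measurable fun h : History d t => F (after N p h) :=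
  (Measurable.of_discrete (f := fun v : Fin t → ℤ => F ((List.ofFn v).foldl advance p))).comp
    (measurable_roundedRewards N t)

lemma after_snoc (p : Prog d α) {t : ℕ} (h : History d t) (x : Action d × ℝ) :
    after N p (Fin.snoc (α := fun _ : Fin (t + 1) => Action d × ℝ) h x : History d (t + 1)) =
      advance (after N p h) ⌊N * x.2⌋ := by
  rw [after, List.ofFn_succ', List.concat_eq_append, List.foldl_append]
  simp only [roundedRewards, Fin.snoc_castSucc, Fin.snoc_last, List.foldl_cons, List.foldl_nil]
  rfl

/-- The learner that follows a program and then plays the returned action forever. -/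
noncomputable def policy (N : ℝ) (c : α → Action d) (p : Prog d α) : Policy d where
  kernel t := Kernel.deterministic (fun h : History d t => next c (after N p h))
    (measurable_comp_after N p t (next c))
  isMarkov _ := inferInstance

/-- One round of the learner that follows a program. -/
noncomputable def roundExp (N : ℝ) (m : Action d → ℝ) (c : α → Action d)
    (Q : Prog d α → ℝ≥0∞) (p : Prog d α) : ℝ≥0∞ :=
  ∫⁻ o, Q (advance p o) ∂(outcome N (m (next c p)))

end Prog

open Prog

variable {d : ℕ} {α β : Type}

lemma measurable_snoc_history {t : ℕ} (g : Action d → ℝ) (hg : Measurable g) :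
    Measurable fun p : (History d t × Action d) × ℝ =>
      (Fin.snoc (α := fun _ : Fin (t + 1) => Action d × ℝ) p.1.1
        (p.1.2, g p.1.2 + p.2) : History d (t + 1)) := by
  refine measurable_pi_lambda _ fun i => ?_
  refine Fin.lastCases ?_ (fun j => ?_) i
  · simp only [Fin.snoc_last]
    fun_prop
  · simp only [Fin.snoc_castSucc]
    fun_prop

lemma isProbabilityMeasure_historyLaw {f : ℝ → ℝ} {θ : Param d} (π : Policy d)
    (hf : Measurable (meanReward f θ)) (t : ℕ) :
    IsProbabilityMeasure (historyLaw f θ π t) := by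
  induction t with
  | zero => unfold historyLaw; infer_instance
  | succ t ih =>
    unfold historyLaw
    have := π.isMarkov t
    exact Measure.isProbabilityMeasure_map (measurable_snoc_history _ hf).aemeasurable

lemma outcome_eq_map (N x : ℝ) :
    outcome N x = (gaussianReal 0 1).map fun z => ⌊N * (x + z)⌋ := by
  have h := gaussianReal_map_const_add (μ := 0) (v := 1) x
  rw [zero_add] at h
  rw [outcome, ← h, Measure.map_map (measurable_floor_mul N) (measurable_const_add x)]
  rfl

lemma lintegral_historyLaw_succ {f : ℝ → ℝ} {θ : Param d} (hf : Measurable (meanReward f θ))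
    (N : ℝ) (c : α → Action d) (p : Prog d α) (t : ℕ) {G : History d (t + 1) → ℝ≥0∞}
    (hG : Measurable G) :
    ∫⁻ h, G h ∂(historyLaw f θ (policy N c p) (t + 1)) =
      ∫⁻ h, ∫⁻ z, G (Fin.snoc (α := fun _ : Fin (t + 1) => Action d × ℝ) h
        (next c (after N p h), meanReward f θ (next c (after N p h)) + z))
          ∂(gaussianReal 0 1) ∂(historyLaw f θ (policy N c p) t) := by
  have := isProbabilityMeasure_historyLaw (policy N c p) hf t
  have := (policy N c p).isMarkov t
  have hs := measurable_snoc_history (t := t) (meanReward f θ) hf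
  have hGs : Measurable fun p : (History d t × Action d) × ℝ =>
      G (Fin.snoc (α := fun _ : Fin (t + 1) => Action d × ℝ) p.1.1
        (p.1.2, meanReward f θ p.1.2 + p.2)) := hG.comp hs
  rw [historyLaw, lintegral_map hG hs, lintegral_prod _ hGs.aemeasurable,
    Measure.lintegral_compProd hGs.lintegral_prod_right']
  refine lintegral_congr fun h => ?_
  exact Kernel.lintegral_deterministic (measurable_comp_after N p t (next c))

/-- Bridge from the measure on histories to the tree semantics: the remaining program is a Markov
chain with transition operator `roundExp`, so histories can be forgotten. -/
lemma lintegral_after {f : ℝ → ℝ} {θ : Param d} (hf : Measurable (meanReward f θ))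
    (N : ℝ) (c : α → Action d) (p : Prog d α) (t : ℕ) (Q : Prog d α → ℝ≥0∞) :
    ∫⁻ h, Q (after N p h) ∂(historyLaw f θ (policy N c p) t) =
      (roundExp N (meanReward f θ) c)^[t] Q p := by
  induction t generalizing Q with
  | zero =>
    rw [historyLaw, lintegral_dirac' _ (measurable_comp_after N p 0 Q)]
    simp [after]
  | succ t ih =>
    rw [lintegral_historyLaw_succ hf N c p t (measurable_comp_after N p _ Q),
      Function.iterate_succ_apply, ← ih]
    refine lintegral_congr fun h => ?_
    simp only [after_snoc, roundExp, outcome_eq_map]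
    rw [lintegral_map .of_discrete]
    exact (measurable_floor_mul N).comp (measurable_const_add _)

lemma roundExp_iterate_of_within {N : ℝ} {m : Action d → ℝ} {c : α → Action d}
    {P : Action d → Prop} {n t : ℕ} {p : Prog d α} (h : Within P n p) (ht : n ≤ t)
    (Q : Prog d α → ℝ≥0∞) :
    (roundExp N m c)^[t] Q p = wp N m p fun x => Q (.ret x) := by
  induction h generalizing t with
  | ret n x =>
    clear ht
    induction t with
    | zero => rfl
    | succ t ih =>
      rw [Function.iterate_succ_apply', roundExp]
      simpa [advance] using ih
  | play ha hk ih =>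
    obtain ⟨k, rfl⟩ : ∃ k, t = k + 1 := ⟨t - 1, by omega⟩
    rw [Function.iterate_succ_apply', roundExp, wp_play]
    exact lintegral_congr fun o => ih o (by omega)

/-- The minimax risk is bounded by the expected loss of any program that ends in time. -/
lemma minimaxRisk_le {f : ℝ → ℝ} (hf : ∀ θ : Param d, Measurable (meanReward f θ)) {N : ℝ}
    {P : Action d → Prop} {T : ℕ} {p : Prog d (Param d)} (hp : Within P T p) (x₀ : Param d)
    {b : ℝ≥0∞}
    (h : ∀ θ, wp N (meanReward f θ) p (fun u => ENNReal.ofReal (estimationLoss f u θ)) ≤ b) :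
    minimaxRisk f d T ≤ b := by
  refine iInf_le_of_le (policy N (fun _ => ⟨0, by simp⟩) p) <|
    iInf_le_of_le (fun h => result x₀ (after N p h)) <|
    iInf_le_of_le (measurable_comp_after N p T (result x₀)) <| iSup_le fun θ => ?_
  rw [lintegral_after (hf θ) N _ p T
    (fun p => ENNReal.ofReal (estimationLoss f (result x₀ p) θ)),
    roundExp_iterate_of_within hp le_rfl]
  exact h θ

/-! ### Accumulated cost and regret -/

namespace Prog

/-- The expected total cost of `T` rounds of the learner that follows a program. -/
noncomputable def cost (N : ℝ) (m : Action d → ℝ) (c : α → Action d) (ρ : Action d → ℝ≥0∞) :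
    ℕ → Prog d α → ℝ≥0∞
  | 0, _ => 0
  | T + 1, p => ρ (next c p) + roundExp N m c (cost N m c ρ T) p

variable {N : ℝ} {m : Action d → ℝ} {c : α → Action d} {ρ : Action d → ℝ≥0∞}

lemma cost_eq_sum (T : ℕ) (p : Prog d α) :
    cost N m c ρ T p =
      ∑ t ∈ Finset.range T, (roundExp N m c)^[t] (fun p => ρ (next c p)) p := by
  induction T generalizing p with
  | zero => simp [cost]
  | succ T ih =>
    rw [cost, Finset.sum_range_succ', add_comm]
    congr 1
    rw [roundExp]
    simp only [ih]
    rw [lintegral_finsetSum _ fun _ _ => .of_discrete]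
    simp only [Function.iterate_succ_apply', roundExp]

lemma cost_succ_play (T : ℕ) (a : Action d) (k : ℤ → Prog d α) :
    cost N m c ρ (T + 1) (play a k) =
      ρ a + ∫⁻ o, cost N m c ρ T (k o) ∂(outcome N (m a)) := rfl

lemma cost_ret (T : ℕ) (x : α) : cost N m c ρ T (ret x) = T * ρ (c x) := by
  induction T with
  | zero => simp [cost]
  | succ T ih =>
    rw [cost, roundExp]
    simp only [advance, ih, lintegral_const, measure_univ, mul_one, next]
    push_cast
    ring

lemma cost_le_mul {B : ℝ≥0∞} (hB : ∀ a, ρ a ≤ B) (T : ℕ) (p : Prog d α) :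
    cost N m c ρ T p ≤ T * B := by
  induction T generalizing p with
  | zero => simp [cost]
  | succ T ih =>
    rw [cost, roundExp]
    calc ρ (next c p) + ∫⁻ o, cost N m c ρ T (advance p o) ∂(outcome N (m (next c p)))
        ≤ B + ∫⁻ _, (T * B : ℝ≥0∞) ∂(outcome N (m (next c p))) := by
          gcongr
          · exact hB _
          · exact ih _
      _ = ((T + 1 : ℕ) : ℝ≥0∞) * B := by
          simp only [lintegral_const, measure_univ, mul_one]
          push_cast
          ring

lemma cost_mono_succ (T : ℕ) (p : Prog d α) :
    cost N m c ρ T p ≤ cost N m c ρ (T + 1) p := by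
  rw [cost_eq_sum, cost_eq_sum, Finset.sum_range_succ]
  exact le_self_add

/-- The first program is charged `B` for each of its at most `n` rounds. The continuation is charged
for the full horizon `T`; it has fewer rounds left, but cost is monotone in the horizon. -/
lemma cost_bind_le {P : Action d → Prop} {B : ℝ≥0∞} (hB : ∀ a, P a → ρ a ≤ B) {n : ℕ}
    {c : β → Action d} {p : Prog d α} (hp : Within P n p) (q : α → Prog d β) (T : ℕ) :
    cost N m c ρ T (p.bind q) ≤ n * B + wp N m p fun x => cost N m c ρ T (q x) := by
  induction hp generalizing T with
  | ret n x => exact le_add_self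
  | @play n a k ha hk ih =>
    cases T with
    | zero => simp [cost]
    | succ T =>
      rw [bind_play, cost_succ_play, wp_play]
      calc ρ a + ∫⁻ o, cost N m c ρ T ((k o).bind q) ∂(outcome N (m a))
          ≤ B + ∫⁻ o, (n * B + wp N m (k o) fun x => cost N m c ρ (T + 1) (q x))
              ∂(outcome N (m a)) := by
            gcongr with o
            · exact hB a ha
            · exact (ih o T).trans
                (add_le_add le_rfl (wp_mono _ fun x => cost_mono_succ T (q x)))
        _ = ((n + 1 : ℕ) : ℝ≥0∞) * B +
            ∫⁻ o, (wp N m (k o) fun x => cost N m c ρ (T + 1) (q x)) ∂(outcome N (m a)) := by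
            rw [lintegral_add_left .of_discrete]
            simp only [lintegral_const, measure_univ, mul_one]
            push_cast
            ring

end Prog

/-- The instantaneous regret of an action. -/
noncomputable def instantRegret (f : ℝ → ℝ) (θ : Param d) (a : Action d) : ℝ :=
  (⨆ a : Action d, meanReward f θ a) - meanReward f θ a

lemma lintegral_pathRegret {f : ℝ → ℝ} {θ : Param d} (hf : Measurable (meanReward f θ))
    (hpos : ∀ a, 0 ≤ instantRegret f θ a) (N : ℝ) (c : α → Action d) (p : Prog d α) (T : ℕ) :
    ∫⁻ h, ENNReal.ofReal (pathRegret f θ h) ∂(historyLaw f θ (policy N c p) T) =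
      cost N (meanReward f θ) c (fun a => ENNReal.ofReal (instantRegret f θ a)) T p := by
  have hm : Measurable fun a => ENNReal.ofReal (instantRegret f θ a) :=
    (measurable_const.sub hf).ennreal_ofReal
  have hpath : ∀ {t : ℕ} (h : History d t), ENNReal.ofReal (pathRegret f θ h) =
      ∑ i : Fin t, ENNReal.ofReal (instantRegret f θ (h i).1) := by
    intro t h
    rw [← ENNReal.ofReal_sum_of_nonneg fun i _ => hpos _]
    simp [pathRegret, instantRegret, Finset.sum_sub_distrib]
  simp only [hpath]
  rw [cost_eq_sum]
  induction T with
  | zero => simp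
  | succ t ih =>
    have := isProbabilityMeasure_historyLaw (policy N c p) hf t
    rw [lintegral_historyLaw_succ hf, Finset.sum_range_succ, ← ih, ← lintegral_after hf,
      ← lintegral_add_left]
    · refine lintegral_congr fun h => ?_
      simp [Fin.sum_univ_castSucc]
    · exact Finset.measurable_sum _ fun i _ => hm.comp
        (measurable_fst.comp (measurable_pi_apply i))
    · exact Finset.measurable_sum _ fun i _ => hm.comp
        (measurable_fst.comp (measurable_pi_apply i))

lemma minimaxRegret_le {f : ℝ → ℝ} (hf : ∀ θ : Param d, Measurable (meanReward f θ))
    (hpos : ∀ (θ : Param d) a, 0 ≤ instantRegret f θ a) {N : ℝ} (c : α → Action d)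
    (p : Prog d α) (T : ℕ) {b : ℝ≥0∞}
    (h : ∀ θ, cost N (meanReward f θ) c (fun a => ENNReal.ofReal (instantRegret f θ a)) T p ≤ b) :
    minimaxRegret f d T ≤ b :=
  iInf_le_of_le (policy N c p) <| iSup_le fun θ =>
    (lintegral_pathRegret (hf θ) (hpos θ) N c p T).trans_le (h θ)

/-! ### Averaging rewards and sub-Gaussian concentration -/

namespace Prog

variable {d : ℕ} {α β : Type} {N : ℝ} {m : Action d → ℝ} {P : Action d → Prop}

/-- Play `a` for `n` rounds and add the rounded rewards to `s`. -/
def tally (a : Action d) : ℕ → ℤ → Prog d ℤ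
  | 0, s => ret s
  | n + 1, s => play a fun o => tally a n (s + o)

/-- Play `a` for `n` rounds and return the average reward. -/
noncomputable def average (N : ℝ) (a : Action d) (n : ℕ) : Prog d ℝ :=
  (tally a n 0).bind fun s => ret (s / N / n)

lemma within_tally {a : Action d} (ha : P a) (n : ℕ) (s : ℤ) : Within P n (tally a n s) := by
  induction n generalizing s with
  | zero => exact .ret _ _
  | succ n ih => exact .play ha fun o => ih _

lemma within_average {a : Action d} (ha : P a) (n : ℕ) : Within P n (average N a n) :=
  (within_tally ha n 0).bind (n' := 0) fun _ => .ret _ _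

lemma lintegral_exp_outcome_le (hN : 0 < N) (x l : ℝ) :
    ∫⁻ o, ENNReal.ofReal (Real.exp (l * (o / N))) ∂(outcome N x) ≤
      ENNReal.ofReal (Real.exp (l * x + l ^ 2 / 2 + |l| / N)) := by
  rw [outcome, lintegral_map .of_discrete (measurable_floor_mul N)]
  calc ∫⁻ r, ENNReal.ofReal (Real.exp (l * (⌊N * r⌋ / N))) ∂(gaussianReal x 1)
      ≤ ∫⁻ r, ENNReal.ofReal (Real.exp (|l| / N) * Real.exp (l * r)) ∂(gaussianReal x 1) := by
        refine lintegral_mono fun r => ENNReal.ofReal_le_ofReal ?_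
        rw [← Real.exp_add, Real.exp_le_exp]
        have h1 : |(⌊N * r⌋ : ℝ) / N - r| ≤ 1 / N := by
          rw [abs_le]
          have h2 := Int.floor_le (N * r)
          have h3 := (Int.lt_floor_add_one (N * r)).le
          constructor
          · rw [neg_le_sub_iff_le_add, ← add_div, le_div_iff₀ hN]; linarith
          · rw [sub_le_iff_le_add, div_le_iff₀ hN, add_mul, one_div_mul_cancel hN.ne']; linarith
        have h4 : l * (⌊N * r⌋ / N) - l * r ≤ |l| * (1 / N) := by
          rw [← mul_sub]
          refine (le_abs_self _).trans ?_
          rw [abs_mul]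
          gcongr
        rw [mul_one_div] at h4
        linarith
    _ = ENNReal.ofReal (Real.exp (l * x + l ^ 2 / 2 + |l| / N)) := by
        rw [← ofReal_integral_eq_lintegral_ofReal
          ((integrable_exp_mul_gaussianReal l).const_mul _)
          (Filter.Eventually.of_forall fun r => by positivity), integral_const_mul]
        have h := congrFun (mgf_id_gaussianReal (μ := x) (v := 1)) l
        simp only [mgf, id] at h
        rw [h, ← Real.exp_add]
        congr 2
        simp
        ring

lemma wp_exp_tally_le (hN : 0 < N) (a : Action d) (l : ℝ) (n : ℕ) (s : ℤ) :
    wp N m (tally a n s) (fun S => ENNReal.ofReal (Real.exp (l * (S / N)))) ≤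
      ENNReal.ofReal (Real.exp (l * (s / N) + n * (l * m a + l ^ 2 / 2 + |l| / N))) := by
  induction n generalizing s with
  | zero => simp [tally]
  | succ n ih =>
    rw [tally, wp_play]
    calc _ ≤ ∫⁻ o, ENNReal.ofReal (Real.exp (l * (s / N) +
            n * (l * m a + l ^ 2 / 2 + |l| / N))) *
              ENNReal.ofReal (Real.exp (l * ((o : ℤ) / N))) ∂(outcome N (m a)) := by
          refine lintegral_mono fun o => (ih _).trans_eq ?_
          rw [← ENNReal.ofReal_mul (by positivity), ← Real.exp_add]
          congr 2
          push_cast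
          ring
      _ ≤ ENNReal.ofReal (Real.exp (l * (s / N) +
            n * (l * m a + l ^ 2 / 2 + |l| / N))) *
              ENNReal.ofReal (Real.exp (l * m a + l ^ 2 / 2 + |l| / N)) := by
          rw [lintegral_const_mul _ .of_discrete]
          gcongr
          exact lintegral_exp_outcome_le hN _ _
      _ = _ := by
          rw [← ENNReal.ofReal_mul (by positivity), ← Real.exp_add]
          congr 2
          push_cast
          ring

/-- Chernoff bound with parameter `l = σ e / 2`. Per round the exponent is `-e²/2 + l²/2 + |l|/N`,
where the last term pays for the rounding and is at most `e²/4` because `2 ≤ N e`; the total is at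
most `-e²/8`. -/
lemma err_average_side_le (hN : 0 < N) (a : Action d) {n : ℕ} (hn : 0 < n) {e : ℝ}
    (he : 2 ≤ N * e) {σ : ℝ} (hσ : |σ| = 1) :
    err N m (average N a n) (fun r => σ * (r - m a) ≤ e) ≤
      ENNReal.ofReal (Real.exp (-(n * e ^ 2 / 8))) := by
  classical
  have he0 : 0 < e := by
    by_contra h
    nlinarith
  have hn' : (0 : ℝ) < n := by exact_mod_cast hn
  have hσ2 : σ ^ 2 = 1 := by rw [← sq_abs, hσ, one_pow]
  set l : ℝ := σ * (e / 2) with hl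
  have hl_abs : |l| = e / 2 := by rw [hl, abs_mul, hσ, one_mul, abs_of_pos (by positivity)]
  rw [err, average, wp_bind]
  calc _ ≤ wp N m (tally a n 0) (fun S => ENNReal.ofReal (Real.exp (-(n * (l * m a + e / 2 * e))))
            * ENNReal.ofReal (Real.exp (l * (S / N)))) := by
        refine wp_mono _ fun S => ?_
        rw [wp_ret]
        split_ifs with h
        · exact zero_le
        · rw [← ENNReal.ofReal_mul (by positivity), ← Real.exp_add, ← ENNReal.ofReal_one]
          refine ENNReal.ofReal_le_ofReal (Real.one_le_exp ?_)
          push Not at h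
          have h1 : n * e ≤ n * (σ * (S / N / n - m a)) := by gcongr
          have h2 : n * (σ * (S / N / n - m a)) = σ * (S / N) - n * (σ * m a) := by
            field_simp
          rw [hl]
          nlinarith
    _ ≤ ENNReal.ofReal (Real.exp (-(n * (l * m a + e / 2 * e)))) *
          ENNReal.ofReal (Real.exp (l * ((0 : ℤ) / N) + n * (l * m a + l ^ 2 / 2 + |l| / N))) := by
        rw [wp_const_mul]
        gcongr
        exact wp_exp_tally_le hN _ _ _ _
    _ ≤ _ := by
        rw [← ENNReal.ofReal_mul (by positivity), ← Real.exp_add]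
        refine ENNReal.ofReal_le_ofReal (Real.exp_le_exp.2 ?_)
        have h3 : |l| / N ≤ e / 2 * (e / 2) := by
          rw [hl_abs, div_le_iff₀ hN]
          nlinarith
        have h4 : l ^ 2 = e ^ 2 / 4 := by rw [hl, mul_pow, hσ2]; ring
        rw [h4]
        have h5 : n * (|l| / N) ≤ n * (e / 2 * (e / 2)) := by gcongr
        simp only [Int.cast_zero, zero_div, mul_zero, zero_add]
        nlinarith

lemma err_average_le (hN : 0 < N) (a : Action d) {n : ℕ} (hn : 0 < n) {e : ℝ}
    (he : 2 ≤ N * e) :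
    err N m (average N a n) (fun r => |r - m a| ≤ e) ≤
      ENNReal.ofReal (2 * Real.exp (-(n * e ^ 2 / 8))) := by
  rw [two_mul, ENNReal.ofReal_add (by positivity) (by positivity)]
  refine (err_or_le _ fun r h1 h2 => ?_).trans (add_le_add
    (err_average_side_le hN a hn he (σ := 1) (by simp))
    (err_average_side_le hN a hn he (σ := -1) (by simp)))
  rw [abs_le]
  constructor <;> linarith

/-- Run finitely many programs one after the other and return all their values. -/
def traverse : (n : ℕ) → (Fin n → Prog d β) → Prog d (Fin n → β)
  | 0, _ => ret fun i => i.elim0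
  | n + 1, p => (p 0).bind fun x => (traverse n fun i => p i.succ).bind fun v => ret (Fin.cons x v)

lemma within_traverse {k n : ℕ} {p : Fin n → Prog d β} (h : ∀ i, Within P k (p i)) :
    Within P (n * k) (traverse n p) := by
  induction n with
  | zero => exact .ret _ _
  | succ n ih =>
    have := (h 0).bind fun x => (ih fun i => h i.succ).bind (n' := 0)
      (q := fun v => ret (Fin.cons x v : Fin (n + 1) → β)) fun v => .ret _ _
    exact this.mono (by ring_nf; rfl)

lemma err_traverse_le {n : ℕ} {p : Fin n → Prog d β} {G : Fin n → β → Prop} {b : ℝ≥0∞}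
    (h : ∀ i, err N m (p i) (G i) ≤ b) :
    err N m (traverse n p) (fun v => ∀ i, G i (v i)) ≤ n * b := by
  induction n with
  | zero => rw [traverse, err_ret_of (fun i => i.elim0)]; exact zero_le
  | succ n ih =>
    rw [traverse]
    refine (err_bind_le (G := G 0) _ _ (b := n * b) fun x hx => ?_).trans ?_
    · refine (err_bind_le (G := fun v => ∀ i, G i.succ (v i)) _ _ (b := 0) fun v hv => ?_).trans ?_
      · refine (err_ret_of fun i => ?_).le
        refine Fin.cases ?_ (fun j => ?_) i
        · simpa using hx
        · simpa using hv j
      · rw [add_zero]; exact ih fun i => h i.succ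
    · push_cast
      rw [add_mul, one_mul, add_comm]
      exact add_le_add le_rfl (h 0)

/-! ### Fair coins from the noise -/

/-- The action `0`, whose reward is pure noise. -/
def zeroAction (d : ℕ) : Action d := ⟨0, by simp⟩

/-- A fair coin, read off from the noise. -/
def flip : Prog d Bool := play (zeroAction d) fun o => ret (decide (0 ≤ o))

lemma gaussianReal_Ici_zero : gaussianReal 0 1 (Ici (0 : ℝ)) = 1 / 2 := by
  have : NullSingletonClass (gaussianReal 0 1) :=
    nullSingletonClass_gaussianReal one_ne_zero
  have h1 : gaussianReal 0 1 (Ici (0 : ℝ)) = gaussianReal 0 1 (Iio 0) := by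
    have h := gaussianReal_map_neg (μ := 0) (v := 1)
    rw [neg_zero] at h
    conv_lhs => rw [← h, Measure.map_apply measurable_neg measurableSet_Ici]
    have : (fun x : ℝ => -x) ⁻¹' Ici 0 = Iic 0 := by ext x; simp
    rw [this]
    exact (measure_congr Iio_ae_eq_Iic).symm
  have h2 := measure_add_measure_compl (μ := gaussianReal 0 1) (measurableSet_Ici (a := (0 : ℝ)))
  rw [compl_Ici, ← h1, measure_univ, ← mul_two] at h2
  rw [ENNReal.eq_div_iff (by simp) (by simp), mul_comm, h2]

lemma wp_flip (hN : 0 < N) (hm : m (zeroAction d) = 0) (Q : Bool → ℝ≥0∞) :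
    wp N m flip Q = (Q true + Q false) / 2 := by
  have h0 : outcome N 0 {o : ℤ | 0 ≤ o} = 1 / 2 := by
    rw [outcome, Measure.map_apply (measurable_floor_mul N) .of_discrete, ← gaussianReal_Ici_zero]
    congr 1
    ext r
    simp [Int.floor_nonneg, hN]
  have h1 : outcome N 0 {o : ℤ | 0 ≤ o}ᶜ = 1 / 2 := by
    rw [prob_compl_eq_one_sub .of_discrete, h0]
    simp
  have h2 : ∫⁻ o in {o : ℤ | 0 ≤ o}, Q (decide (0 ≤ o)) ∂(outcome N 0) = Q true * (1 / 2) := by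
    rw [setLIntegral_congr_fun (g := fun _ => Q true) .of_discrete, lintegral_const,
      Measure.restrict_apply_univ, h0]
    intro o ho
    have : (0 : ℤ) ≤ o := ho
    simp [this]
  have h3 : ∫⁻ o in {o : ℤ | 0 ≤ o}ᶜ, Q (decide (0 ≤ o)) ∂(outcome N 0) = Q false * (1 / 2) := by
    rw [setLIntegral_congr_fun (g := fun _ => Q false) .of_discrete, lintegral_const,
      Measure.restrict_apply_univ, h1]
    intro o ho
    have : ¬ (0 : ℤ) ≤ o := ho
    simp [this]
  rw [flip, wp_play, hm, ← lintegral_add_compl _ (.of_discrete : MeasurableSet {o : ℤ | 0 ≤ o})]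
  simp only [wp_ret]
  rw [h2, h3, ← add_mul, mul_one_div]

/-- Independent fair coins. -/
def signs (n : ℕ) : Prog d (Fin n → Bool) := traverse n fun _ => flip

lemma within_signs (h0 : P (zeroAction d)) (n : ℕ) : Within P n (signs n : Prog d _) := by
  have := within_traverse (k := 1) (n := n) (p := fun _ => (flip : Prog d Bool)) (P := P)
    fun _ => .play h0 fun _ => .ret _ _
  simpa [signs] using this

end Prog

open Prog

/-! ### Anti-concentration of random sign sums -/

/-- The sign of a coin. -/
def coinSign (b : Bool) : ℝ := if b then 1 else -1

/-- The expectation over independent fair coins. -/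
noncomputable def signMean : (n : ℕ) → ((Fin n → Bool) → ℝ) → ℝ
  | 0, F => F fun i => i.elim0
  | n + 1, F =>
    (signMean n (fun v => F (Fin.cons true v)) + signMean n (fun v => F (Fin.cons false v))) / 2

lemma signMean_nonneg {n : ℕ} {F : (Fin n → Bool) → ℝ} (hF : ∀ v, 0 ≤ F v) :
    0 ≤ signMean n F := by
  induction n with
  | zero => exact hF _
  | succ n ih =>
    have h1 := ih fun v => hF (Fin.cons true v)
    have h2 := ih fun v => hF (Fin.cons false v)
    rw [signMean]
    linarith

lemma wp_signs {d : ℕ} {N : ℝ} {m : Action d → ℝ} (hN : 0 < N) (hm : m (zeroAction d) = 0)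
    {n : ℕ} {F : (Fin n → Bool) → ℝ} (hF : ∀ v, 0 ≤ F v) :
    wp N m (signs n) (fun v => ENNReal.ofReal (F v)) = ENNReal.ofReal (signMean n F) := by
  induction n with
  | zero => rfl
  | succ n ih =>
    rw [signs, Prog.traverse, wp_bind, wp_flip hN hm]
    simp only [wp_bind, wp_ret]
    have h (b : Bool) := ih (F := fun v => F (Fin.cons b v)) fun v => hF _
    simp only [signs] at h
    rw [h, h, signMean, ← ENNReal.ofReal_add (signMean_nonneg fun v => hF _)
      (signMean_nonneg fun v => hF _), ENNReal.ofReal_div_of_pos two_pos, ENNReal.ofReal_ofNat]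

/-- Only the fourth moment is not exact: its true value is smaller by `2 ∑ uᵢ⁴`, which is dropped
thanks to `0 ≤ A`. The shift `x` is there for the induction on the number of signs. -/
lemma signMean_quartic_le {A : ℝ} (hA : 0 ≤ A) (B C D E : ℝ) {n : ℕ} (u : Fin n → ℝ) (x : ℝ) :
    signMean n (fun v => A * (x + ∑ i, u i * coinSign (v i)) ^ 4
      + B * (x + ∑ i, u i * coinSign (v i)) ^ 3 + C * (x + ∑ i, u i * coinSign (v i)) ^ 2
      + D * (x + ∑ i, u i * coinSign (v i)) + E) ≤
    A * (x ^ 4 + 6 * x ^ 2 * ∑ i, u i ^ 2 + 3 * (∑ i, u i ^ 2) ^ 2)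
      + B * (x ^ 3 + 3 * x * ∑ i, u i ^ 2) + C * (x ^ 2 + ∑ i, u i ^ 2) + D * x + E := by
  induction n generalizing x with
  | zero => simp [signMean]
  | succ n ih =>
    rw [signMean]
    simp only [Fin.sum_univ_succ, Fin.cons_zero, Fin.cons_succ, coinSign, if_true, ← add_assoc,
      Bool.false_eq_true, if_false, mul_one, mul_neg] at ih ⊢
    have h1 := ih (fun i => u i.succ) (x + u 0)
    have h2 := ih (fun i => u i.succ) (x + -u 0)
    have h3 : 0 ≤ A * u 0 ^ 4 := by positivity
    nlinarith

/-- A quartic `φ ≥ 0` that is at least `1` off `[1/4, 4]` has mean below `49/50`, so it bounds the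
failure probability. Being asymmetric, it excludes negative sums as well as sums that are too small
or too large; its odd moments vanish. -/
lemma err_signs_le {d : ℕ} {N : ℝ} {m : Action d → ℝ} (hN : 0 < N) (hm : m (zeroAction d) = 0)
    {n : ℕ} (u : Fin n → ℝ) (h1 : 3 / 4 ≤ ∑ i, u i ^ 2) (h2 : ∑ i, u i ^ 2 ≤ 1) :
    err N m (signs n) (fun v => (∑ i, u i * coinSign (v i)) ∈ Icc (1 / 4 : ℝ) 4) ≤
      ENNReal.ofReal (49 / 50) := by
  classical
  -- On `[1/4, 4]` the first two factors multiply to at most `(15/8)² ≤ 88/25` and the square is at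
  -- most `25`; hence `88`.
  set φ : ℝ → ℝ := fun S => 1 - (S - 1 / 4) * (4 - S) * (S + 1) ^ 2 / 88 with hφ
  have hφ1 : ∀ S, S ∉ Icc (1 / 4 : ℝ) 4 → 1 ≤ φ S := by
    intro S hS
    have : (S - 1 / 4) * (4 - S) ≤ 0 := by
      by_contra h
      push Not at h
      apply hS
      constructor <;> nlinarith
    have := mul_nonpos_of_nonpos_of_nonneg this (sq_nonneg (S + 1))
    simp only [hφ]
    linarith
  have hφ0 : ∀ S, 0 ≤ φ S := by
    intro S
    by_cases hS : S ∈ Icc (1 / 4 : ℝ) 4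
    · have h3 : (S - 1 / 4) * (4 - S) ≤ 88 / 25 := by nlinarith [sq_nonneg (S - 17 / 8)]
      have h4 : (S + 1) ^ 2 ≤ 25 := by nlinarith [hS.1, hS.2]
      have h5 : 0 ≤ (S - 1 / 4) * (4 - S) :=
        mul_nonneg (by linarith [hS.1]) (by linarith [hS.2])
      have h6 := mul_le_mul h3 h4 (sq_nonneg _) (by norm_num)
      simp only [hφ]
      linarith
    · linarith [hφ1 S hS]
  rw [err]
  calc _ ≤ wp N m (signs n) (fun v => ENNReal.ofReal (φ (∑ i, u i * coinSign (v i)))) := by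
        refine wp_mono _ fun v => ?_
        split_ifs with h
        · exact zero_le
        · rw [← ENNReal.ofReal_one]
          exact ENNReal.ofReal_le_ofReal (hφ1 _ h)
    _ = ENNReal.ofReal (signMean n fun v => φ (∑ i, u i * coinSign (v i))) :=
        wp_signs hN hm fun v => hφ0 _
    _ ≤ _ := by
        refine ENNReal.ofReal_le_ofReal ?_
        have h := signMean_quartic_le (A := 1 / 88) (by norm_num) (-(9 / 4) / 88) (-(13 / 2) / 88)
          (-(9 / 4) / 88) (89 / 88) u 0
        have h' : (fun v : Fin n → Bool => φ (∑ i, u i * coinSign (v i))) = fun v =>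
            1 / 88 * (0 + ∑ i, u i * coinSign (v i)) ^ 4
            + -(9 / 4) / 88 * (0 + ∑ i, u i * coinSign (v i)) ^ 3
            + -(13 / 2) / 88 * (0 + ∑ i, u i * coinSign (v i)) ^ 2
            + -(9 / 4) / 88 * (0 + ∑ i, u i * coinSign (v i)) + 89 / 88 := by
          funext v
          simp only [hφ]
          ring
        rw [h']
        refine h.trans ?_
        nlinarith

/-! ### Repeating trials until one succeeds -/

namespace Prog

variable {d : ℕ} {β : Type} {N : ℝ} {m : Action d → ℝ} {P : Action d → Prop}

/-- Run programs until one of them finds a value. -/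
def firstOf : List (Prog d (Option β)) → Prog d (Option β)
  | [] => ret none
  | p :: l => p.bind fun r => r.elim (firstOf l) fun b => ret (some b)

lemma within_firstOf {k : ℕ} {l : List (Prog d (Option β))} (h : ∀ p ∈ l, Within P k p) :
    Within P (l.length * k) (firstOf l) := by
  induction l with
  | nil => exact .ret _ _
  | cons p l ih =>
    have := (h p (by simp)).bind (n' := l.length * k)
      (q := fun r => r.elim (firstOf l) fun b => ret (some b)) fun r => by
        cases r with
        | none => exact ih fun p hp => h p (by simp [hp])
        | some b => exact .ret _ _
    exact this.mono (by simp only [List.length_cons]; ring_nf; rfl)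

lemma err_firstOf_sound_le {G : β → Prop} {b : ℝ≥0∞} {l : List (Prog d (Option β))}
    (h : ∀ p ∈ l, err N m p (fun r => ∀ x ∈ r, G x) ≤ b) :
    err N m (firstOf l) (fun r => ∀ x ∈ r, G x) ≤ l.length * b := by
  induction l with
  | nil => rw [firstOf, err_ret_of (by simp)]; exact zero_le
  | cons p l ih =>
    rw [firstOf]
    refine (err_bind_le _ _ (b := l.length * b) fun r hr => ?_).trans
      ((add_le_add (h p (by simp)) le_rfl).trans_eq ?_)
    · cases r with
      | none => exact ih fun p hp => h p (by simp [hp])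
      | some x =>
        rw [Option.elim_some, err_ret_of hr]
        exact zero_le
    · simp only [List.length_cons]
      push_cast
      ring

/-- A later program runs only if all earlier ones found nothing, and it runs with fresh noise, so
the failure probabilities multiply exactly. This is what makes repeated trials fail with
exponentially small probability. -/
lemma err_firstOf_isSome (l : List (Prog d (Option β))) :
    err N m (firstOf l) (fun r => r.isSome) = (l.map fun p => err N m p fun r => r.isSome).prod := by
  classical
  induction l with
  | nil => simp [firstOf, err]
  | cons p l ih =>
    rw [List.map_cons, List.prod_cons, ← ih, firstOf, err, wp_bind, err, mul_comm, ← wp_const_mul]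
    congr 1
    funext r
    cases r <;> simp [err]

lemma err_firstOf_isSome_le {l : List (Prog d (Option β))} {p : Prog d (Option β)} (hp : p ∈ l) :
    err N m (firstOf l) (fun r => r.isSome) ≤ err N m p fun r => r.isSome := by
  obtain ⟨s, t, rfl⟩ := List.append_of_mem hp
  have h (l : List (Prog d (Option β))) :
      (l.map fun p => err N m p fun r => r.isSome).prod ≤ 1 := by
    rw [← err_firstOf_isSome]
    exact err_le_one _ _
  rw [err_firstOf_isSome, List.map_append, List.prod_append, List.map_cons, List.prod_cons]
  calc _ ≤ 1 * ((err N m p fun r => r.isSome) * 1) := by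
        gcongr
        · exact h s
        · exact h t
    _ = _ := by simp

end Prog

/-! ### Random directions and the geometry of an improvement -/

open Prog
open scoped InnerProductSpace

/-- The Euclidean space of the actions. -/
abbrev Vec (d : ℕ) : Type := EuclideanSpace ℝ (Fin d)

open Classical in
/-- A vector as an action, where vectors outside of the unit ball are replaced by `0`. -/
noncomputable def toAction {d : ℕ} (x : Vec d) : Action d :=
  if h : ‖x‖ ≤ 1 then ⟨x, by simpa using h⟩ else zeroAction d

lemma coe_toAction {d : ℕ} {x : Vec d} (h : ‖x‖ ≤ 1) : (toAction x : Vec d) = x := by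
  rw [toAction, dif_pos h]

/-- The unit vector whose coordinates have the signs given by coins. -/
noncomputable def signVector {d : ℕ} (v : Fin d → Bool) : Vec d :=
  WithLp.toLp 2 fun i => coinSign (v i) / √d

lemma coinSign_sq (b : Bool) : coinSign b ^ 2 = 1 := by cases b <;> simp [coinSign]

lemma norm_signVector {d : ℕ} (hd : 1 ≤ d) (v : Fin d → Bool) : ‖signVector v‖ = 1 := by
  have hd' : (d : ℝ) ≠ 0 := by positivity
  rw [EuclideanSpace.norm_eq]
  simp [signVector, div_pow, coinSign_sq, hd']

lemma inner_signVector {d : ℕ} (u : Vec d) (v : Fin d → Bool) :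
    ⟪u, signVector v⟫_ℝ = (∑ i, u i * coinSign (v i)) / √d := by
  simp only [signVector, PiLp.inner_apply, RCLike.inner_apply, conj_trivial, Finset.sum_div]
  exact Finset.sum_congr rfl fun i _ => by ring

lemma err_signVector_le {d : ℕ} (hd : 1 ≤ d) {N : ℝ} {m : Action d → ℝ} (hN : 0 < N)
    (hm : m (zeroAction d) = 0) {u : Vec d} (h1 : 3 / 4 ≤ ‖u‖ ^ 2) (h2 : ‖u‖ ^ 2 ≤ 1) :
    err N m (signs d) (fun v => ⟪u, signVector v⟫_ℝ ∈ Icc (1 / (4 * √d)) (4 / √d)) ≤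
      ENNReal.ofReal (49 / 50) := by
  have hd' : 0 < √(d : ℝ) := Real.sqrt_pos.2 (by positivity)
  rw [EuclideanSpace.real_norm_sq_eq] at h1 h2
  refine (err_mono _ fun v hv => ?_).trans (err_signs_le hN hm (fun i => u i) h1 h2)
  rw [inner_signVector, mem_Icc, div_le_div_iff_of_pos_right hd', ← div_div,
    div_le_div_iff_of_pos_right hd']
  exact hv

/-- The component of a sign vector orthogonal to a unit vector `a`. -/
noncomputable def orthPart {d : ℕ} (a : Vec d) (v : Fin d → Bool) : Vec d :=
  signVector v - ⟪a, signVector v⟫_ℝ • a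

section Geometry

variable {d : ℕ} {a θ : Vec d}

lemma inner_orthPart_self (ha : ‖a‖ = 1) (v : Fin d → Bool) : ⟪a, orthPart a v⟫_ℝ = 0 := by
  rw [orthPart, inner_sub_right, inner_smul_right, real_inner_self_eq_norm_sq, ha]
  ring

lemma norm_orthPart_le (hd : 1 ≤ d) (ha : ‖a‖ = 1) (v : Fin d → Bool) : ‖orthPart a v‖ ≤ 1 := by
  have h : ‖orthPart a v‖ ^ 2 = 1 - ⟪a, signVector v⟫_ℝ ^ 2 := by
    rw [orthPart, norm_sub_sq_real, norm_smul, ha, norm_signVector hd, inner_smul_right,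
      real_inner_comm, mul_one, Real.norm_eq_abs, sq_abs]
    ring
  rw [← sq_le_one_iff₀ (norm_nonneg _), h]
  nlinarith

lemma inner_orthPart (v : Fin d → Bool) :
    ⟪θ, orthPart a v⟫_ℝ = ⟪θ - ⟪θ, a⟫_ℝ • a, signVector v⟫_ℝ := by
  rw [orthPart, inner_sub_right, inner_smul_right, inner_sub_left, real_inner_smul_left]
  ring

/-- Projecting the sign vector amounts to projecting `θ`, and the projected `θ` has squared norm `1
- ⟪θ, a⟫² ≥ 3/4`. -/
lemma err_orthPart_le (hd : 1 ≤ d) {N : ℝ} {m : Action d → ℝ} (hN : 0 < N)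
    (hm : m (zeroAction d) = 0) (ha : ‖a‖ = 1) (hθ : ‖θ‖ = 1) (h0 : 0 ≤ ⟪θ, a⟫_ℝ)
    (h : ⟪θ, a⟫_ℝ ≤ 1 / 2) :
    err N m (signs d) (fun v => ⟪θ, orthPart a v⟫_ℝ ∈ Icc (1 / (4 * √d)) (4 / √d)) ≤
      ENNReal.ofReal (49 / 50) := by
  simp only [inner_orthPart]
  have hn : ‖θ - ⟪θ, a⟫_ℝ • a‖ ^ 2 = 1 - ⟪θ, a⟫_ℝ ^ 2 := by
    rw [norm_sub_sq_real, norm_smul, ha, hθ, inner_smul_right, mul_one, Real.norm_eq_abs, sq_abs]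
    ring
  exact err_signVector_le hd hN hm (by rw [hn]; nlinarith) (by rw [hn]; nlinarith)

/-- The normalized combination of `a` and `w` with weights `x` and `g`. -/
noncomputable def improve (x g : ℝ) (a w : Vec d) : Vec d :=
  ‖x • a + g • w‖⁻¹ • (x • a + g • w)

/-- Before normalization the correlation is at least `x² + g²`, while by orthogonality the norm is
at most `√(x² + g²)`. Only lower bounds on the two correlations enter. -/
lemma norm_improve_and_le_inner {x g : ℝ} {w : Vec d} (ha : ‖a‖ = 1) (hw : ‖w‖ ≤ 1)
    (haw : ⟪a, w⟫_ℝ = 0) (hx : 0 < x) (hg : 0 ≤ g) (hxa : x ≤ ⟪θ, a⟫_ℝ) (hgw : g ≤ ⟪θ, w⟫_ℝ) :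
    ‖improve x g a w‖ = 1 ∧ √(x ^ 2 + g ^ 2) ≤ ⟪θ, improve x g a w⟫_ℝ := by
  have hsq : ‖x • a + g • w‖ ^ 2 = x ^ 2 + g ^ 2 * ‖w‖ ^ 2 := by
    rw [norm_add_sq_real, norm_smul, norm_smul, real_inner_smul_left, inner_smul_right, haw, ha,
      mul_pow, mul_pow, Real.norm_eq_abs, Real.norm_eq_abs, sq_abs, sq_abs]
    ring
  have hpos : 0 < ‖x • a + g • w‖ := by
    refine (norm_nonneg _).lt_of_ne fun h => ?_
    rw [← h] at hsq
    have : 0 ≤ g ^ 2 * ‖w‖ ^ 2 := by positivity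
    nlinarith
  have hle : ‖x • a + g • w‖ ≤ √(x ^ 2 + g ^ 2) := by
    refine Real.le_sqrt_of_sq_le ?_
    rw [hsq]
    have : ‖w‖ ^ 2 ≤ 1 := by nlinarith [norm_nonneg w]
    nlinarith [sq_nonneg g]
  constructor
  · rw [improve, norm_smul, norm_inv, norm_norm, inv_mul_cancel₀ hpos.ne']
  · rw [improve, inner_smul_right, inner_add_right, inner_smul_right, inner_smul_right,
      inv_mul_eq_div, le_div_iff₀ hpos]
    have h2 : √(x ^ 2 + g ^ 2) ^ 2 = x ^ 2 + g ^ 2 := Real.sq_sqrt (by positivity)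
    have h3 := mul_le_mul_of_nonneg_left hle (Real.sqrt_nonneg (x ^ 2 + g ^ 2))
    nlinarith

end Geometry

/-! ### Comparing two arguments through a steep window -/

/-- The function `f` grows with slope at least `s` on `[y / 2, y]`. -/
def SteepOn (f : ℝ → ℝ) (y s : ℝ) : Prop :=
  ∀ t t', y / 2 ≤ t' → t' ≤ t → t ≤ y → s * (t - t') ≤ f t - f t'

/-- The readings `r₁`, `r₂` of two values of `f` up to an error `e` show that the arguments differ
by more than `η`. -/
def Separated (f : ℝ → ℝ) (y η e r₁ r₂ : ℝ) : Prop :=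
  ∃ t ∈ Icc (y / 2 + 3 * η) y, f t - e ≤ r₁ ∧ r₂ ≤ f (t - 3 * η) + e

/-- A reading error moves an argument past `t` or `t - 3η` by at most `η`, since `f` rises by `s η >
2 e` over that length: `z₁ ≥ t - η` and `z₂ < t - 2η`. The arguments need not lie in the window, and
`z₂` may be negative, since monotonicity on `[0, 1]` handles everything outside. -/
lemma Separated.lt_sub {f : ℝ → ℝ} {y s η e r₁ r₂ z₁ z₂ : ℝ} (hf : MonotoneOn f (Icc 0 1))
    (hs : SteepOn f y s) (hy1 : y ≤ 1) (hη : 0 < η) (he : 2 * e < s * η)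
    (h : Separated f y η e r₁ r₂) (hz₁ : z₁ ∈ Icc (0 : ℝ) 1) (hz₂ : z₂ ≤ 1)
    (hr₁ : |r₁ - f z₁| ≤ e) (hr₂ : |r₂ - f z₂| ≤ e) : η < z₁ - z₂ := by
  obtain ⟨t, ⟨ht1, ht2⟩, h1, h2⟩ := h
  rw [abs_le] at hr₁ hr₂
  have h3 : t - η ≤ z₁ := by
    by_contra hlt
    push Not at hlt
    have h4 := hf hz₁ ⟨by linarith [hz₁.1], by linarith⟩ hlt.le
    have h5 := hs t (t - η) (by linarith) (by linarith) ht2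
    linarith
  have h4 : z₂ < t - 2 * η := by
    by_contra hlt
    push Not at hlt
    have h5 := hf ⟨by linarith, by linarith⟩ ⟨by linarith, hz₂⟩ hlt
    have h6 := hs (t - 2 * η) (t - 3 * η) (by linarith) (by linarith) (by linarith)
    have h7 : s * (t - 2 * η - (t - 3 * η)) = s * η := by ring
    linarith
  linarith

lemma separated_of_le {f : ℝ → ℝ} {y η e r₁ r₂ z₁ z₂ : ℝ} (hf : MonotoneOn f (Icc 0 1))
    (hy1 : y ≤ 1) (hη : 0 < η) (hz₁ : z₁ ∈ Icc (y / 2 + 3 * η) y) (hz₂ : 0 ≤ z₂)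
    (hz : z₂ ≤ z₁ - 3 * η) (hr₁ : |r₁ - f z₁| ≤ e) (hr₂ : |r₂ - f z₂| ≤ e) :
    Separated f y η e r₁ r₂ := by
  rw [abs_le] at hr₁ hr₂
  refine ⟨z₁, hz₁, by linarith, ?_⟩
  have := hf ⟨hz₂, by linarith [hz₁.2]⟩ ⟨by linarith, by linarith [hz₁.2]⟩ hz
  linarith

/-- The first scale that falls to `y` or below overshoots by a factor of at most `3/4`. Landing
above `5y/8` leaves the margin `y/8 ≥ 3η` over `y/2` that `Separated` asks for. The exponent starts
at `1` so that the scaled action has norm at most `3/4`, with room for the shift by `μ ≤ 1/4`. -/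
lemma exists_pow_mul_mem {y u : ℝ} (hy : 0 < y) (hyu : y ≤ u) (hu : u < 1) {L : ℕ}
    (hL : (3 / 4 : ℝ) ^ L ≤ y) : ∃ i < L, (3 / 4 : ℝ) ^ (i + 1) * u ∈ Icc (5 / 8 * y) y := by
  classical
  have hu0 : 0 ≤ u := hy.le.trans hyu
  have hex : ∃ i, (3 / 4 : ℝ) ^ (i + 1) * u ≤ y := by
    refine ⟨L, ?_⟩
    have h1 : 3 / 4 * u ≤ 1 := by linarith
    have : (3 / 4 : ℝ) ^ L * (3 / 4 * u) ≤ y * 1 := by gcongr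
    rw [pow_succ]
    linarith
  refine ⟨Nat.find hex, ?_, ?_, Nat.find_spec hex⟩
  · by_contra hlt
    push Not at hlt
    cases hL0 : L with
    | zero =>
      subst hL0
      rw [pow_zero] at hL
      linarith
    | succ l =>
      subst hL0
      have := Nat.find_min hex (m := l) (by omega)
      apply this
      have : (3 / 4 : ℝ) ^ (l + 1) * u ≤ y * 1 := mul_le_mul hL hu.le hu0 hy.le
      linarith
  · rcases hi : Nat.find hex with _ | j
    · norm_num
      linarith
    · have h := Nat.find_min hex (m := j) (by omega)
      push Not at h
      rw [pow_succ]
      linarith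

/-! ### One improvement step -/

section Programs

variable {d : ℕ} {β : Type}

open Classical in
/-- Play two actions and return `x` if the average rewards satisfy `R`. -/
noncomputable def compare (N : ℝ) (n : ℕ) (a₁ a₂ : Action d) (R : ℝ → ℝ → Prop) (x : β) :
    Prog d (Option β) :=
  (average N a₁ n).bind fun r₁ => (average N a₂ n).bind fun r₂ =>
    ret (if R r₁ r₂ then some x else none)

lemma within_compare (N : ℝ) (n : ℕ) (a₁ a₂ : Action d) (R : ℝ → ℝ → Prop) (x : β) :
    Within (fun _ => True) (n + n) (compare N n a₁ a₂ R x) :=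
  (within_average trivial n).bind fun _ =>
    (within_average trivial n).bind (n' := 0) fun _ => .ret _ _

open Classical in
lemma err_compare_le {N e : ℝ} {m : Action d → ℝ} {n : ℕ} {b : ℝ≥0∞}
    (hb : ∀ a, err N m (average N a n) (fun r => |r - m a| ≤ e) ≤ b) {a₁ a₂ : Action d}
    {R : ℝ → ℝ → Prop} {x : β} {G : Option β → Prop}
    (h : ∀ r₁ r₂, |r₁ - m a₁| ≤ e → |r₂ - m a₂| ≤ e → G (if R r₁ r₂ then some x else none)) :
    err N m (compare N n a₁ a₂ R x) G ≤ 2 * b := by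
  rw [two_mul]
  refine (err_bind_le _ _ (b := b) fun r₁ hr₁ => ?_).trans (add_le_add (hb a₁) le_rfl)
  refine (err_bind_le (G := fun r => |r - m a₂| ≤ e) _ _ (b := 0) fun r₂ hr₂ => ?_).trans ?_
  · exact (err_ret_of (h r₁ r₂ hr₁ hr₂)).le
  · rw [add_zero]; exact hb a₂

/-- Draw a random direction and test, at all scales of `a`, whether it is positively correlated
with the parameter. -/
noncomputable def trial (f : ℝ → ℝ) (N y η e μ : ℝ) (n L : ℕ) (a : Vec d) :
    Prog d (Option (Fin d → Bool)) :=
  (signs d).bind fun v => firstOf ((List.range L).map fun i =>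
    compare N n (toAction ((3 / 4 : ℝ) ^ (i + 1) • a))
      (toAction ((3 / 4 : ℝ) ^ (i + 1) • a - μ • orthPart a v)) (Separated f y η e) v)

/-- Improve the action `a`, of correlation at least `x`, by a direction found in `M` trials. -/
noncomputable def climbStep (f : ℝ → ℝ) (N x g y η e μ : ℝ) (n L M : ℕ) (a : Vec d) :
    Prog d (Vec d) :=
  (firstOf (List.replicate M (trial f N y η e μ n L a))).bind fun r =>
    ret (r.elim a fun v => improve x g a (orthPart a v))

lemma within_climbStep (f : ℝ → ℝ) (N x g y η e μ : ℝ) (n L M : ℕ) (a : Vec d) :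
    Within (fun _ => True) (M * (d + L * (n + n))) (climbStep f N x g y η e μ n L M a) := by
  have h : Within (fun _ => True) (d + L * (n + n)) (trial f N y η e μ n L a) := by
    refine (within_signs trivial d).bind fun v => ?_
    have := within_firstOf (P := fun _ => True) (k := n + n) (l := (List.range L).map fun i =>
      compare N n (toAction ((3 / 4 : ℝ) ^ (i + 1) • a))
        (toAction ((3 / 4 : ℝ) ^ (i + 1) • a - μ • orthPart a v)) (Separated f y η e) v) (by
          simp only [List.mem_map]
          rintro p ⟨i, -, rfl⟩
          exact within_compare _ _ _ _ _ _)
    simpa using this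
  have h2 := within_firstOf (l := List.replicate M (trial f N y η e μ n L a)) fun p hp => by
    rw [List.eq_of_mem_replicate hp]
    exact h
  rw [List.length_replicate] at h2
  exact h2.bind (n' := 0) fun _ => .ret _ _

variable {f : ℝ → ℝ} {N x g y s η e μ : ℝ} {m : Action d → ℝ} {n L M : ℕ} {a θ : Vec d} {b : ℝ≥0∞}

lemma inner_le_one_of_norm_le {u : Vec d} (hθ : ‖θ‖ = 1) (hu : ‖u‖ ≤ 1) : ⟪θ, u⟫_ℝ ≤ 1 :=
  (real_inner_le_norm θ u).trans (by rw [hθ, one_mul]; exact hu)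

lemma norm_scaled_le (ha : ‖a‖ = 1) (i : ℕ) : ‖(3 / 4 : ℝ) ^ (i + 1) • a‖ ≤ 3 / 4 := by
  rw [norm_smul, ha, mul_one, Real.norm_eq_abs, abs_of_pos (by positivity), pow_succ]
  have : (3 / 4 : ℝ) ^ i ≤ 1 := pow_le_one₀ (by norm_num) (by norm_num)
  linarith

lemma norm_shifted_le (hd : 1 ≤ d) (ha : ‖a‖ = 1) (hμ : 0 < μ) (hμ4 : μ ≤ 1 / 4) (i : ℕ)
    (v : Fin d → Bool) : ‖(3 / 4 : ℝ) ^ (i + 1) • a - μ • orthPart a v‖ ≤ 1 := by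
  refine (norm_sub_le _ _).trans ?_
  have h1 := norm_scaled_le ha i
  have h2 : ‖μ • orthPart a v‖ ≤ 1 / 4 * 1 := by
    rw [norm_smul, Real.norm_eq_abs, abs_of_pos hμ]
    gcongr
    exact norm_orthPart_le hd ha v
  linarith

lemma err_trial_sound_le (hd : 1 ≤ d) (hf : MonotoneOn f (Icc 0 1)) (hs : SteepOn f y s)
    (hy1 : y ≤ 1) (hη : 0 < η) (he : 2 * e < s * η) (hμ : 0 < μ) (hμ4 : μ ≤ 1 / 4)
    (hb : ∀ a, err N m (average N a n) (fun r => |r - m a| ≤ e) ≤ b)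
    (hm : ∀ a : Action d, m a = f ⟪θ, (a : Vec d)⟫_ℝ) (hθ : ‖θ‖ = 1) (ha : ‖a‖ = 1)
    (hθa : 0 ≤ ⟪θ, a⟫_ℝ) :
    err N m (trial f N y η e μ n L a) (fun r => ∀ v ∈ r, η < μ * ⟪θ, orthPart a v⟫_ℝ) ≤
      L * (2 * b) := by
  rw [trial]
  refine (err_bind_le (G := fun _ => True) _ _ (b := L * (2 * b)) fun v _ => ?_).trans ?_
  · have := err_firstOf_sound_le (N := N) (m := m) (b := 2 * b)
      (G := fun v => η < μ * ⟪θ, orthPart a v⟫_ℝ) (l := (List.range L).map fun i =>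
      compare N n (toAction ((3 / 4 : ℝ) ^ (i + 1) • a))
        (toAction ((3 / 4 : ℝ) ^ (i + 1) • a - μ • orthPart a v)) (Separated f y η e) v) (by
          simp only [List.mem_map]
          rintro p ⟨i, -, rfl⟩
          refine err_compare_le hb fun r₁ r₂ h1 h2 => ?_
          split_ifs with hR
          · have hn1 : ‖(3 / 4 : ℝ) ^ (i + 1) • a‖ ≤ 1 := (norm_scaled_le ha i).trans (by norm_num)
            have hn2 := norm_shifted_le hd ha hμ hμ4 i v
            rw [hm, coe_toAction hn1] at h1
            rw [hm, coe_toAction hn2] at h2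
            have h3 := hR.lt_sub hf hs hy1 hη he
              ⟨by rw [inner_smul_right]; positivity, inner_le_one_of_norm_le hθ hn1⟩
              (inner_le_one_of_norm_le hθ hn2) h1 h2
            rw [inner_sub_right, sub_sub_cancel, inner_smul_right] at h3
            simpa using h3
          · simp)
    simpa using this
  · simp [err]

lemma err_trial_isSome_le (hd : 1 ≤ d) (hN : 0 < N) (hf0 : f 0 = 0)
    (hf : MonotoneOn f (Icc 0 1)) (hy : 0 < y) (hη : 0 < η)
    (hη1 : 3 * η ≤ μ / (4 * √d)) (hη2 : 3 * η ≤ y / 8) (hμ : 0 < μ) (hμ4 : μ ≤ 1 / 4)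
    (hμy : μ * (4 / √d) ≤ y / 2) (hL : (3 / 4 : ℝ) ^ L ≤ y)
    (hb : ∀ a, err N m (average N a n) (fun r => |r - m a| ≤ e) ≤ b)
    (hm : ∀ a : Action d, m a = f ⟪θ, (a : Vec d)⟫_ℝ) (hθ : ‖θ‖ = 1) (ha : ‖a‖ = 1)
    (hya : y ≤ ⟪θ, a⟫_ℝ) (hθa : ⟪θ, a⟫_ℝ ≤ 1 / 2) :
    err N m (trial f N y η e μ n L a) (fun r => r.isSome) ≤ ENNReal.ofReal (49 / 50) + 2 * b := by
  have hm0 : m (zeroAction d) = 0 := by rw [hm]; simp [zeroAction, hf0]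
  obtain ⟨i, hi, hi1, hi2⟩ := exists_pow_mul_mem hy hya (by linarith) hL
  rw [trial]
  refine (err_bind_le _ _ fun v hv => ?_).trans (add_le_add
    (err_orthPart_le hd hN hm0 ha hθ (hy.le.trans hya) hθa) le_rfl)
  refine (err_firstOf_isSome_le (List.mem_map_of_mem (List.mem_range.2 hi))).trans ?_
  refine err_compare_le hb fun r₁ r₂ h1 h2 => ?_
  have hn1 : ‖(3 / 4 : ℝ) ^ (i + 1) • a‖ ≤ 1 := (norm_scaled_le ha i).trans (by norm_num)
  have hn2 := norm_shifted_le hd ha hμ hμ4 i v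
  rw [hm, coe_toAction hn1, inner_smul_right] at h1
  rw [hm, coe_toAction hn2, inner_sub_right, inner_smul_right, inner_smul_right] at h2
  have h3 : μ * (1 / (4 * √d)) ≤ μ * ⟪θ, orthPart a v⟫_ℝ := by gcongr; exact hv.1
  -- The upper bound on the correlation keeps the shifted argument nonnegative, where `f` is
  -- monotone.
  have h4 : μ * ⟪θ, orthPart a v⟫_ℝ ≤ μ * (4 / √d) := by gcongr; exact hv.2
  rw [mul_one_div] at h3
  rw [if_pos (separated_of_le hf (by linarith) hη ⟨by linarith, hi2⟩ (by linarith)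
    (by linarith) h1 h2)]
  rfl

lemma err_climbStep_le (hd : 1 ≤ d) (hN : 0 < N) (hf0 : f 0 = 0) (hf : MonotoneOn f (Icc 0 1))
    (hs : SteepOn f y s) (hy : 0 < y) (hη : 0 < η)
    (hη1 : 3 * η ≤ μ / (4 * √d)) (hη2 : 3 * η ≤ y / 8) (he : 2 * e < s * η)
    (hμ : 0 < μ) (hμ4 : μ ≤ 1 / 4) (hμy : μ * (4 / √d) ≤ y / 2) (hL : (3 / 4 : ℝ) ^ L ≤ y)
    (hb : ∀ a, err N m (average N a n) (fun r => |r - m a| ≤ e) ≤ b)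
    (hm : ∀ a : Action d, m a = f ⟪θ, (a : Vec d)⟫_ℝ) (hθ : ‖θ‖ = 1) (ha : ‖a‖ = 1)
    (hyx : y ≤ x) (hxa : x ≤ ⟪θ, a⟫_ℝ) (hg : 0 ≤ g) (hgη : g * μ ≤ η)
    (hxg : √(x ^ 2 + g ^ 2) ≤ 1 / 2) :
    err N m (climbStep f N x g y η e μ n L M a)
        (fun a' => ‖a'‖ = 1 ∧ √(x ^ 2 + g ^ 2) ≤ ⟪θ, a'⟫_ℝ) ≤
      M * (L * (2 * b)) + (ENNReal.ofReal (49 / 50) + 2 * b) ^ M := by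
  have hy1 : y ≤ 1 := hyx.trans (hxa.trans (inner_le_one_of_norm_le hθ ha.le))
  have hx : 0 < x := hy.trans_le hyx
  have hsound : err N m (firstOf (List.replicate M (trial f N y η e μ n L a)))
      (fun r => ∀ v ∈ r, η < μ * ⟪θ, orthPart a v⟫_ℝ) ≤ M * (L * (2 * b)) := by
    have := err_firstOf_sound_le (N := N) (m := m) (b := L * (2 * b))
      (G := fun v => η < μ * ⟪θ, orthPart a v⟫_ℝ)
      (l := List.replicate M (trial f N y η e μ n L a)) fun p hp => by
        rw [List.eq_of_mem_replicate hp]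
        exact err_trial_sound_le hd hf hs hy1 hη he hμ hμ4 hb hm hθ ha (hx.le.trans hxa)
    rwa [List.length_replicate] at this
  have hgood : ∀ v : Fin d → Bool, η < μ * ⟪θ, orthPart a v⟫_ℝ →
      ‖improve x g a (orthPart a v)‖ = 1 ∧
        √(x ^ 2 + g ^ 2) ≤ ⟪θ, improve x g a (orthPart a v)⟫_ℝ := by
    intro v hv
    refine norm_improve_and_le_inner ha (norm_orthPart_le hd ha v) (inner_orthPart_self ha v) hx hg
      hxa ?_
    refine le_of_mul_le_mul_right ?_ hμ
    linarith
  rw [climbStep]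
  -- Beyond correlation `1/2` no good direction is guaranteed, but keeping `a` is then enough, since
  -- the target level is at most `1/2`. Soundness of an accepted direction is needed in both cases.
  by_cases hθa : ⟪θ, a⟫_ℝ ≤ 1 / 2
  · have hsome : err N m (firstOf (List.replicate M (trial f N y η e μ n L a)))
        (fun r => r.isSome) ≤ (ENNReal.ofReal (49 / 50) + 2 * b) ^ M := by
      rw [err_firstOf_isSome, List.map_replicate, List.prod_replicate]
      exact pow_le_pow_left' (err_trial_isSome_le hd hN hf0 hf hy hη hη1 hη2 hμ hμ4 hμy hL hb hm
        hθ ha (hyx.trans hxa) hθa) M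
    refine (err_bind_le (G := fun r => (∀ v ∈ r, η < μ * ⟪θ, orthPart a v⟫_ℝ) ∧ r.isSome)
      _ _ (b := 0) ?_).trans ?_
    · rintro (_ | v) ⟨hr1, hr2⟩
      · simp at hr2
      · exact le_of_eq (err_ret_of (G := fun a' => ‖a'‖ = 1 ∧ √(x ^ 2 + g ^ 2) ≤ ⟪θ, a'⟫_ℝ)
        (hgood v (hr1 v rfl)))
    · rw [add_zero]
      exact (err_or_le _ fun r h1 h2 => ⟨h1, h2⟩).trans (add_le_add hsound hsome)
  · push Not at hθa
    refine (err_bind_le _ _ (b := 0) ?_).trans (add_le_add hsound zero_le)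
    rintro (_ | v) hr1
    · exact (err_ret_of ⟨ha, hxg.trans hθa.le⟩).le
    · exact le_of_eq (err_ret_of (G := fun a' => ‖a'‖ = 1 ∧ √(x ^ 2 + g ^ 2) ≤ ⟪θ, a'⟫_ℝ)
        (hgood v (hr1 v rfl)))

end Programs

/-! ### The sign ambiguity of even links, and measurability -/

/-- The vectors that produce the same rewards as the parameter `θ`. -/
def SameRewards {d : ℕ} (f : ℝ → ℝ) (θ ϑ : Vec d) : Prop :=
  ϑ = θ ∨ (EvenLink f ∧ ϑ = -θ)

lemma abs_inner_le_one {d : ℕ} {θ u : Vec d} (hθ : ‖θ‖ = 1) (hu : ‖u‖ ≤ 1) : |⟪θ, u⟫_ℝ| ≤ 1 :=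
  (abs_real_inner_le_norm θ u).trans (by rw [hθ, one_mul]; exact hu)

lemma norm_param {d : ℕ} (θ : Param d) : ‖(θ : Vec d)‖ = 1 :=
  mem_sphere_zero_iff_norm.1 θ.2

lemma norm_action_le {d : ℕ} (a : Action d) : ‖(a : Vec d)‖ ≤ 1 :=
  mem_closedBall_zero_iff.1 a.2

lemma SameRewards.norm_eq {d : ℕ} {f : ℝ → ℝ} {θ : Param d} {ϑ : Vec d}
    (h : SameRewards f θ ϑ) : ‖ϑ‖ = 1 := by
  rcases h with rfl | ⟨-, rfl⟩
  · exact norm_param θ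
  · rw [norm_neg]; exact norm_param θ

lemma SameRewards.meanReward_eq {d : ℕ} {f : ℝ → ℝ} {θ : Param d} {ϑ : Vec d}
    (h : SameRewards f θ ϑ) (a : Action d) : meanReward f θ a = f ⟪ϑ, (a : Vec d)⟫_ℝ := by
  rcases h with rfl | ⟨hf, rfl⟩
  · rfl
  · rw [inner_neg_left, hf _ (abs_le.1 (abs_inner_le_one (norm_param θ) (norm_action_le a)))]
    rfl

lemma BurnInRegular.monotoneOn {f : ℝ → ℝ} (h : BurnInRegular f) : MonotoneOn f (Icc 0 1) := by
  rcases h.monotone with h | h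
  · exact h.mono (Icc_subset_Icc (by norm_num) le_rfl)
  · exact h.2

/-- Nothing is known about `f` outside `[-1, 1]`, so it is replaced by a monotone extension of its
restriction to `[-1, 1]`, or to `[0, 1]` in the even case, where the argument is replaced by its
absolute value. -/
lemma BurnInRegular.measurable_meanReward {f : ℝ → ℝ} (h : BurnInRegular f) {d : ℕ}
    (θ : Param d) : Measurable (meanReward f θ) := by
  have hin : Measurable fun a : Action d => ⟪(θ : Vec d), (a : Vec d)⟫_ℝ := by
    have : Continuous fun a : Action d => ⟪(θ : Vec d), (a : Vec d)⟫_ℝ := by fun_prop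
    exact this.measurable
  have hmem : ∀ a : Action d, |⟪(θ : Vec d), (a : Vec d)⟫_ℝ| ≤ 1 := fun a =>
    abs_inner_le_one (norm_param θ) (norm_action_le a)
  have hext : ∀ {l : ℝ} (hl : l ≤ 1), MonotoneOn f (Icc l 1) →
      Monotone (IccExtend hl fun x => f x) := fun hl hm =>
    Monotone.IccExtend (fun x y hxy => hm x.2 y.2 hxy) (h := hl)
  rcases h.monotone with hm | ⟨he, hm⟩
  · convert (hext (by norm_num) hm).measurable.comp hin using 1
    funext a
    rw [Function.comp_apply, IccExtend_of_mem _ _ (abs_le.1 (hmem a))]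
    rfl
  · convert (hext zero_le_one hm).measurable.comp hin.abs using 1
    funext a
    rw [Function.comp_apply, IccExtend_of_mem _ _ ⟨abs_nonneg _, hmem a⟩]
    change f _ = f |⟪(θ : Vec d), (a : Vec d)⟫_ℝ|
    rcases abs_choice ⟪(θ : Vec d), (a : Vec d)⟫_ℝ with h | h <;> rw [h]
    exact (he _ (abs_le.1 (hmem a))).symm

/-! ### The first direction -/

section Start

variable {d : ℕ} {f : ℝ → ℝ} {N x y s e : ℝ} {n M : ℕ} {b : ℝ≥0∞}

open Classical in
/-- Draw a random direction and test whether its correlation with the parameter is at least `x`. -/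
noncomputable def firstTrial (f : ℝ → ℝ) (N x y e : ℝ) (d n : ℕ) : Prog d (Option (Fin d → Bool)) :=
  (signs d).bind fun v => (average N (toAction ((y / (2 * x)) • signVector v)) n).bind fun r =>
    ret (if f y - e ≤ r then some v else none)

/-- Find a first direction of correlation at least `x` in `M` trials. -/
noncomputable def start (f : ℝ → ℝ) (N x y e : ℝ) (d n M : ℕ) : Prog d (Vec d) :=
  (firstOf (List.replicate M (firstTrial f N x y e d n))).bind fun r => ret (r.elim 0 signVector)

lemma within_start (f : ℝ → ℝ) (N x y e : ℝ) (d n M : ℕ) :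
    Within (fun _ => True) (M * (d + n)) (start f N x y e d n M) := by
  have h : Within (fun _ => True) (d + n) (firstTrial f N x y e d n) :=
    (within_signs trivial d).bind fun v => (within_average trivial n).bind (n' := 0) fun _ =>
      .ret _ _
  have h2 := within_firstOf (l := List.replicate M (firstTrial f N x y e d n)) fun p hp => by
    rw [List.eq_of_mem_replicate hp]
    exact h
  rw [List.length_replicate] at h2
  exact h2.bind (n' := 0) fun _ => .ret _ _

/-- A reading near `f y` forces the value above `f (y/2)`, because `f y - f (y/2) ≥ s y / 2 > 2 e`.
Hence the argument, or its absolute value for an even link, exceeds `y/2`, and undoing the scaling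
by `y / (2x)` gives correlation `x` with `θ` or `-θ`. -/
lemma exists_sameRewards_of_reading (hf : BurnInRegular f) (hs : SteepOn f y s) (hy : 0 < y)
    (hyx : y ≤ x) (hx : x ≤ 1 / 2) (he : 4 * e < s * y) {θ : Param d} {w : Vec d} (hw : ‖w‖ ≤ 1)
    {r : ℝ} (hr : |r - f ⟪(θ : Vec d), (y / (2 * x)) • w⟫_ℝ| ≤ e) (h : f y - e ≤ r) :
    ∃ ϑ, SameRewards f θ ϑ ∧ x ≤ ⟪ϑ, w⟫_ℝ := by
  have hx0 : 0 < x := hy.trans_le hyx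
  have hsy := hs y (y / 2) le_rfl (by linarith) le_rfl
  rw [abs_le] at hr
  have hz : f (y / 2) < f ⟪(θ : Vec d), (y / (2 * x)) • w⟫_ℝ := by linarith
  have hlam : y / (2 * x) ≤ 1 / 2 := by
    rw [div_le_div_iff₀ (by positivity) two_pos]
    linarith
  have hin := abs_inner_le_one (norm_param θ) hw
  rw [inner_smul_right] at hz
  have hz1 : |y / (2 * x) * ⟪(θ : Vec d), w⟫_ℝ| ≤ 1 / 2 * 1 := by
    rw [abs_mul, abs_of_pos (by positivity : 0 < y / (2 * x))]
    gcongr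
  have key : ∀ z : ℝ, y / 2 < y / (2 * x) * z → x ≤ z := by
    intro z hz
    have h1 : y / (2 * x) * z = y / 2 * (z / x) := by field_simp
    rw [h1] at hz
    have h2 : 1 < z / x := by
      by_contra hlt
      push Not at hlt
      have := mul_le_mul_of_nonneg_left hlt (by positivity : 0 ≤ y / 2)
      linarith
    rw [lt_div_iff₀ hx0] at h2
    linarith
  have hz2 := abs_le.1 hz1
  rcases hf.monotone with hm | ⟨hev, hm⟩
  · refine ⟨θ, Or.inl rfl, key _ ?_⟩
    by_contra hlt
    push Not at hlt
    have := hm ⟨by linarith, by linarith⟩ ⟨by linarith, by linarith⟩ hlt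
    linarith
  · have habs : f |y / (2 * x) * ⟪(θ : Vec d), w⟫_ℝ| = f (y / (2 * x) * ⟪(θ : Vec d), w⟫_ℝ) := by
      rcases abs_choice (y / (2 * x) * ⟪(θ : Vec d), w⟫_ℝ) with h | h <;> rw [h]
      exact hev _ ⟨by linarith, by linarith⟩
    have hgt : y / 2 < |y / (2 * x) * ⟪(θ : Vec d), w⟫_ℝ| := by
      by_contra hlt
      push Not at hlt
      have := hm ⟨abs_nonneg _, by linarith⟩ ⟨by linarith, by linarith⟩ hlt
      linarith
    rcases lt_abs.1 hgt with h | h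
    · exact ⟨θ, Or.inl rfl, key _ h⟩
    · refine ⟨-θ, Or.inr ⟨hev, rfl⟩, key _ ?_⟩
      rw [inner_neg_left]
      linarith

lemma err_start_le (hd : 1 ≤ d) (hN : 0 < N) (hf : BurnInRegular f) (hs : SteepOn f y s)
    (hy : 0 < y) (hyx : y ≤ x) (hx : x ≤ 1 / 2) (hxd : 2 * x ≤ 1 / (4 * √d)) (he : 4 * e < s * y)
    {θ : Param d}
    (hb : ∀ a, err N (meanReward f θ) (average N a n) (fun r => |r - meanReward f θ a| ≤ e) ≤ b) :
    err N (meanReward f θ) (start f N x y e d n M)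
        (fun a => ‖a‖ = 1 ∧ ∃ ϑ, SameRewards f θ ϑ ∧ x ≤ ⟪ϑ, a⟫_ℝ) ≤
      M * b + (ENNReal.ofReal (49 / 50) + b) ^ M := by
  have hx0 : 0 < x := hy.trans_le hyx
  have hm0 : meanReward f θ (zeroAction d) = 0 := by simp [meanReward, zeroAction, hf.zero]
  have hlam : y / (2 * x) ≤ 1 / 2 := by
    rw [div_le_div_iff₀ (by positivity) two_pos]
    linarith
  have hnorm : ∀ v : Fin d → Bool, ‖(y / (2 * x)) • signVector v‖ ≤ 1 := by
    intro v
    rw [norm_smul, norm_signVector hd, Real.norm_eq_abs, abs_of_pos (by positivity)]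
    linarith
  have hsound : err N (meanReward f θ) (firstTrial f N x y e d n)
      (fun r => ∀ v ∈ r, ∃ ϑ, SameRewards f θ ϑ ∧ x ≤ ⟪ϑ, signVector v⟫_ℝ) ≤ b := by
    rw [firstTrial]
    refine (err_bind_le (G := fun _ => True) _ _ (b := b) fun v _ => ?_).trans
      (by simp [err])
    refine (err_bind_le (b := 0) _ _ fun r hr => ?_).trans
      ((add_zero _).trans_le (hb (toAction ((y / (2 * x)) • signVector v))))
    refine (err_ret_of ?_).le
    split_ifs with h
    · intro v' hv'
      obtain rfl : v = v' := by simpa using hv'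
      rw [meanReward, coe_toAction (hnorm v)] at hr
      exact exists_sameRewards_of_reading hf hs hy hyx hx he (norm_signVector hd v).le hr h
    · simp
  have hsome : err N (meanReward f θ) (firstTrial f N x y e d n) (fun r => r.isSome) ≤
      ENNReal.ofReal (49 / 50) + b := by
    rw [firstTrial]
    have hθ2 : ‖(θ : Vec d)‖ ^ 2 = 1 := by rw [norm_param, one_pow]
    refine (err_bind_le _ _ (b := b) fun v hv => ?_).trans (add_le_add
      (err_signVector_le hd hN hm0 (u := (θ : Vec d)) (by rw [hθ2]; norm_num) hθ2.le) le_rfl)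
    refine (err_bind_le (b := 0) _ _ fun r hr => ?_).trans
      ((add_zero _).trans_le (hb (toAction ((y / (2 * x)) • signVector v))))
    refine (err_ret_of ?_).le
    rw [meanReward, coe_toAction (hnorm v)] at hr
    have h1 : y ≤ ⟪(θ : Vec d), (y / (2 * x)) • signVector v⟫_ℝ := by
      rw [inner_smul_right, div_mul_eq_mul_div, le_div_iff₀ (by positivity)]
      have := hxd.trans hv.1
      gcongr
    have h2 := hf.monotoneOn ⟨hy.le, by linarith⟩
      ⟨hy.le.trans h1, inner_le_one_of_norm_le (norm_param θ) (hnorm v)⟩ h1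
    rw [abs_le] at hr
    rw [if_pos (by linarith)]
    rfl
  rw [start]
  refine (err_bind_le (G := fun r => (∀ v ∈ r, ∃ ϑ, SameRewards f θ ϑ ∧ x ≤ ⟪ϑ, signVector v⟫_ℝ)
    ∧ r.isSome) _ _ (b := 0) ?_).trans ?_
  · rintro (_ | v) ⟨hr1, hr2⟩
    · simp at hr2
    · exact le_of_eq (err_ret_of (G := fun a => ‖a‖ = 1 ∧ ∃ ϑ, SameRewards f θ ϑ ∧ x ≤ ⟪ϑ, a⟫_ℝ)
        ⟨norm_signVector hd v, hr1 v rfl⟩)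
  · rw [add_zero]
    refine (err_or_le _ fun r h1 h2 => ⟨h1, h2⟩).trans (add_le_add ?_ ?_)
    · have := err_firstOf_sound_le (N := N) (m := meanReward f θ) (b := b)
        (G := fun v => ∃ ϑ, SameRewards f θ ϑ ∧ x ≤ ⟪ϑ, signVector v⟫_ℝ)
        (l := List.replicate M (firstTrial f N x y e d n)) fun p hp => by
          rw [List.eq_of_mem_replicate hp]
          exact hsound
      rwa [List.length_replicate] at this
    · rw [err_firstOf_isSome, List.map_replicate, List.prod_replicate]
      exact pow_le_pow_left' hsome M

end Start

/-! ### Iterating the improvement -/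

section Climb

/-- The first action, improved `k` times. The correlation level after `k` improvements is `x k`;
the level `y k` of the tests, the accuracy `e k` and the sample size `n k` vary with `k`. -/
noncomputable def climb (f : ℝ → ℝ) (N g η μ : ℝ) (x y e : ℕ → ℝ) (d : ℕ) (n : ℕ → ℕ) (L M : ℕ) :
    ℕ → Prog d (Vec d)
  | 0 => start f N (x 0) (y 0) (e 0) d (n 0) M
  | k + 1 => (climb f N g η μ x y e d n L M k).bind
      (climbStep f N (x k) g (y k) η (e k) μ (n k) L M)

variable {d : ℕ} {f : ℝ → ℝ} {N g η μ : ℝ} {x y e s : ℕ → ℝ} {n : ℕ → ℕ} {L M : ℕ} {b : ℝ≥0∞}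

lemma within_climb (f : ℝ → ℝ) (N g η μ : ℝ) (x y e : ℕ → ℝ) (d : ℕ) (n : ℕ → ℕ) (L M k : ℕ) :
    Within (fun _ => True) (M * (d + n 0) + ∑ i ∈ Finset.range k, M * (d + L * (n i + n i)))
      (climb f N g η μ x y e d n L M k) := by
  induction k with
  | zero => exact within_start f N (x 0) (y 0) (e 0) d (n 0) M
  | succ k ih =>
    rw [Finset.sum_range_succ, ← add_assoc]
    exact ih.bind fun a => within_climbStep _ _ _ _ _ _ _ _ _ _ _ _

lemma err_climb_le (hd : 1 ≤ d) (hN : 0 < N) (hf : BurnInRegular f) (hη : 0 < η)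
    (hη1 : 3 * η ≤ μ / (4 * √d)) (hμ : 0 < μ) (hμ4 : μ ≤ 1 / 4) (hg : 0 ≤ g) (hgη : g * μ ≤ η)
    {θ : Param d} (hL1 : 1 ≤ L) (hxd : 2 * x 0 ≤ 1 / (4 * √d)) {k : ℕ} (hk : ∀ i ≤ k, x i ≤ 1 / 2)
    (hx : ∀ i < k, x (i + 1) = √(x i ^ 2 + g ^ 2))
    (hyx : ∀ i ≤ k, y i ≤ x i) (hy : ∀ i ≤ k, 0 < y i)
    (hs : ∀ i ≤ k, SteepOn f (y i) (s i)) (he : ∀ i ≤ k, 2 * e i < s i * η)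
    (hη2 : ∀ i ≤ k, 3 * η ≤ y i / 8) (hμy : ∀ i ≤ k, μ * (4 / √d) ≤ y i / 2)
    (hL : ∀ i ≤ k, (3 / 4 : ℝ) ^ L ≤ y i)  (he0 : 4 * e 0 < s 0 * y 0)
    (hb : ∀ i ≤ k, ∀ a, err N (meanReward f θ) (average N a (n i))
      (fun r => |r - meanReward f θ a| ≤ e i) ≤ b) :
    err N (meanReward f θ) (climb f N g η μ x y e d n L M k)
        (fun a => ‖a‖ = 1 ∧ ∃ ϑ, SameRewards f θ ϑ ∧ x k ≤ ⟪ϑ, a⟫_ℝ) ≤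
      (k + 1 : ℕ) * (M * (L * (2 * b)) + (ENNReal.ofReal (49 / 50) + 2 * b) ^ M) := by
  induction k with
  | zero =>
    refine (err_start_le hd hN hf (hs 0 le_rfl) (hy 0 le_rfl) (hyx 0 le_rfl) (hk 0 le_rfl) hxd
      he0 (hb 0 le_rfl)).trans ?_
    have h1 : b ≤ 2 * b := by rw [two_mul]; exact le_self_add
    have h2 : b ≤ L * (2 * b) := by
      calc b = 1 * b := (one_mul b).symm
        _ ≤ L * (2 * b) := mul_le_mul' (by exact_mod_cast hL1) h1
    simp only [zero_add, Nat.cast_one, one_mul]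
    gcongr
  | succ k ih =>
    have hlast := Nat.lt_succ_self k
    rw [Nat.cast_succ (k + 1), add_mul, one_mul, climb]
    refine (err_bind_le _ _ ?_).trans (add_le_add (ih (fun i hi => hk i (by omega))
      (fun i hi => hx i (by omega)) (fun i hi => hyx i (by omega)) (fun i hi => hy i (by omega))
      (fun i hi => hs i (by omega)) (fun i hi => he i (by omega)) (fun i hi => hη2 i (by omega))
      (fun i hi => hμy i (by omega)) (fun i hi => hL i (by omega))
      (fun i hi => hb i (by omega))) le_rfl)
    -- The next step is analyzed against `ϑ` instead of `θ`: the rewards are the same, and the sign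
    -- chosen at the start persists.
    rintro a ⟨ha, ϑ, hϑ, hxa⟩
    have hk' := hx k (by omega)
    refine (err_mono _ fun a' ha' => ?_).trans (err_climbStep_le (θ := ϑ) hd hN hf.zero
      hf.monotoneOn (hs k (by omega)) (hy k (by omega)) hη hη1 (hη2 k (by omega))
      (he k (by omega)) hμ hμ4 (hμy k (by omega)) (hL k (by omega)) (hb k (by omega))
      hϑ.meanReward_eq hϑ.norm_eq ha (hyx k (by omega)) hxa hg hgη
      (by rw [← hk']; exact hk (k + 1) le_rfl))
    rw [hk']
    exact ⟨ha'.1, ϑ, hϑ, ha'.2⟩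

end Climb

/-! ### Learning from a good action -/

/-- Readings of the values of `f` at `⟨ϑ, p i⟩` and a bound on the correlation with `a`
determine `u`. -/
def Consistent {d k : ℕ} (f : ℝ → ℝ) (e : ℝ) (a : Vec d) (p : Fin k → Vec d) (r : Fin k → ℝ)
    (u : Vec d) : Prop :=
  1 / 2 ≤ ⟪u, a⟫_ℝ ∧ ∀ i, |r i - f ⟪u, p i⟫_ℝ| ≤ e

section Learn

variable {d : ℕ}

/-- The actions played around a good action `a`. -/
noncomputable def probe (a : Vec d) : Fin (d + 1) → Vec d :=
  Fin.cons ((1 / 2 : ℝ) • a) fun i =>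
    (1 / 2 : ℝ) • a + (3 / 20 : ℝ) • EuclideanSpace.single i (1 : ℝ)

open Classical in
/-- A unit vector that is consistent with the readings, if there is one. -/
noncomputable def decode (f : ℝ → ℝ) (e : ℝ) (a : Vec d) (u₀ : Param d)
    (r : Fin (d + 1) → ℝ) : Param d :=
  if h : ∃ u : Param d, Consistent f e a (probe a) r (u : Vec d) then h.choose else u₀

/-- Estimate the parameter, starting from a good action `a`. -/
noncomputable def learn (f : ℝ → ℝ) (N e : ℝ) (n : ℕ) (u₀ : Param d) (a : Vec d) :
    Prog d (Param d) :=
  (traverse (d + 1) fun i => average N (toAction (probe a i)) n).bind fun r =>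
    ret (decode f e a u₀ r)

lemma within_learn {P : Action d → Prop} (f : ℝ → ℝ) (N e : ℝ) (n : ℕ) (u₀ : Param d) {a : Vec d}
    (h : ∀ i, P (toAction (probe a i))) : Within P ((d + 1) * n) (learn f N e n u₀ a) :=
  (within_traverse fun i => within_average (h i) n).bind (n' := 0) fun _ => .ret _ _

lemma norm_probe_le {a : Vec d} (ha : ‖a‖ = 1) (i : Fin (d + 1)) : ‖probe a i‖ ≤ 1 := by
  have h : ‖(1 / 2 : ℝ) • a‖ = 1 / 2 := by
    rw [norm_smul, ha]
    norm_num
  refine Fin.cases ?_ (fun j => ?_) i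
  · simp only [probe, Fin.cons_zero, h]
    norm_num
  · simp only [probe, Fin.cons_succ]
    refine (norm_add_le _ _).trans ?_
    rw [h, norm_smul, PiLp.norm_single]
    norm_num

lemma inner_probe_ge {a u : Vec d} (hu : ‖u‖ = 1) (hua : 1 / 2 ≤ ⟪u, a⟫_ℝ) (i : Fin (d + 1)) :
    1 / 10 ≤ ⟪u, probe a i⟫_ℝ := by
  refine Fin.cases ?_ (fun j => ?_) i
  · simp only [probe, Fin.cons_zero, inner_smul_right]
    linarith
  · simp only [probe, Fin.cons_succ, inner_add_right, inner_smul_right]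
    have h := abs_inner_le_one hu (u := EuclideanSpace.single j (1 : ℝ)) (by simp)
    -- `1/4 - 3/20 = 1/10` is the left end of the range where the slope is controlled.
    linarith [(abs_le.1 h).1]

lemma LearningRegular.sub_le {f : ℝ → ℝ} {cf Cf : ℝ} (h : LearningRegular f cf Cf) {x y : ℝ}
    (hx : 1 / 10 ≤ x) (hxy : x ≤ y) (hy : y ≤ 1) :
    cf * (y - x) ≤ f y - f x ∧ f y - f x ≤ Cf * (y - x) := by
  have hd : ∀ z ∈ interior (Icc (1 / 10 : ℝ) 1),
      derivWithin f (Icc (1 / 10) 1) z = deriv f z := fun z hz =>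
    derivWithin_of_mem_nhds (mem_interior_iff_mem_nhds.1 hz)
  have hdiff := h.differentiable.mono interior_subset
  constructor
  · exact (convex_Icc _ _).mul_sub_le_image_sub_of_le_deriv h.differentiable.continuousOn hdiff
      (fun z hz => (h.lower z (interior_subset hz)).trans_eq (hd z hz)) x ⟨hx, hxy.trans hy⟩ y
      ⟨hx.trans hxy, hy⟩ hxy
  · exact (convex_Icc _ _).image_sub_le_mul_sub_of_deriv_le h.differentiable.continuousOn hdiff
      (fun z hz => (hd z hz).symm.trans_le (h.upper z (interior_subset hz))) x ⟨hx, hxy.trans hy⟩ y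
      ⟨hx.trans hxy, hy⟩ hxy

lemma LearningRegular.abs_sub_le {f : ℝ → ℝ} {cf Cf : ℝ} (h : LearningRegular f cf Cf) {x y : ℝ}
    (hx : x ∈ Icc (1 / 10 : ℝ) 1) (hy : y ∈ Icc (1 / 10 : ℝ) 1) :
    cf * |x - y| ≤ |f x - f y| := by
  wlog hxy : x ≤ y generalizing x y
  · rw [abs_sub_comm, abs_sub_comm (f x)]
    exact this hy hx (le_of_not_ge hxy)
  rw [abs_sub_comm, abs_sub_comm (f x), abs_of_nonneg (sub_nonneg.2 hxy)]
  exact (h.sub_le hx.1 hxy hy.2).1.trans (le_abs_self _)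

/-- Two consistent vectors have arguments within `2 e / cf` at each probe. Subtracting the probe
`a/2` isolates the coordinates, and for unit vectors `1 - ⟪u, ϑ⟫` is half the squared distance. -/
lemma one_sub_inner_le_of_consistent {f : ℝ → ℝ} {cf Cf : ℝ} (h : LearningRegular f cf Cf)
    {e : ℝ} {a u ϑ : Vec d} {r : Fin (d + 1) → ℝ} (ha : ‖a‖ = 1) (hu : ‖u‖ = 1) (hϑ : ‖ϑ‖ = 1)
    (h1 : Consistent f e a (probe a) r u) (h2 : Consistent f e a (probe a) r ϑ) :
    1 - ⟪u, ϑ⟫_ℝ ≤ d * (400 * (e / cf) ^ 2) := by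
  have hcf := h.pos
  have hp : ∀ i, |⟪u, probe a i⟫_ℝ - ⟪ϑ, probe a i⟫_ℝ| ≤ 2 * (e / cf) := by
    intro i
    have h3 := h.abs_sub_le
      ⟨inner_probe_ge hu h1.1 i, inner_le_one_of_norm_le hu (norm_probe_le ha i)⟩
      ⟨inner_probe_ge hϑ h2.1 i, inner_le_one_of_norm_le hϑ (norm_probe_le ha i)⟩
    have h4 := abs_sub_le (f ⟪u, probe a i⟫_ℝ) (r i) (f ⟪ϑ, probe a i⟫_ℝ)
    rw [abs_sub_comm _ (r i)] at h4
    have h5 := h1.2 i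
    have h6 := h2.2 i
    rw [← mul_div_assoc, le_div_iff₀ hcf]
    linarith
  have hc : ∀ j : Fin d, (u - ϑ) j ^ 2 ≤ 2 * (400 * (e / cf) ^ 2) := by
    intro j
    have h3 := hp 0
    have h4 := hp j.succ
    simp only [probe, Fin.cons_zero, Fin.cons_succ, inner_smul_right, inner_add_right] at h3 h4
    have h5 : ∀ v : Vec d, ⟪v, EuclideanSpace.single j (1 : ℝ)⟫_ℝ = v j := by
      intro v
      rw [EuclideanSpace.inner_single_right]
      simp
    rw [h5, h5] at h4
    rw [abs_le] at h3 h4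
    -- Two argument errors of `2 e / cf`, divided by the step `3/20`; `(80/3)² ≤ 800`.
    have h6 : |(u - ϑ) j| ≤ 80 / 3 * (e / cf) := by
      rw [PiLp.sub_apply, abs_le]
      constructor <;> linarith
    rw [← sq_abs]
    nlinarith [abs_nonneg ((u - ϑ) j)]
  have hn : ‖u - ϑ‖ ^ 2 ≤ d * (2 * (400 * (e / cf) ^ 2)) := by
    rw [EuclideanSpace.real_norm_sq_eq]
    refine (Finset.sum_le_card_nsmul _ _ _ fun j _ => hc j).trans_eq ?_
    simp
  rw [norm_sub_sq_real, hu, hϑ] at hn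
  linarith

/-- When all readings are accurate, `ϑ` itself is consistent, so `decode` does not fall back on its
default and its choice is close to `ϑ`. -/
lemma err_learn_le {f : ℝ → ℝ} {cf Cf : ℝ} (h : LearningRegular f cf Cf) {N e : ℝ} {n : ℕ}
    {b : ℝ≥0∞} (u₀ : Param d) {a : Vec d} {θ : Param d} {ϑ : Vec d} (hϑ : SameRewards f θ ϑ)
    (ha : ‖a‖ = 1) (hϑa : 1 / 2 ≤ ⟪ϑ, a⟫_ℝ)
    (hb : ∀ a, err N (meanReward f θ) (average N a n) (fun r => |r - meanReward f θ a| ≤ e) ≤ b) :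
    err N (meanReward f θ) (learn f N e n u₀ a)
      (fun u => 1 - ⟪(u : Vec d), ϑ⟫_ℝ ≤ d * (400 * (e / cf) ^ 2)) ≤ (d + 1 : ℕ) * b := by
  rw [learn]
  refine (err_bind_le _ _ (b := 0) fun r hr => ?_).trans
    ((add_zero _).trans_le (err_traverse_le fun i => hb (toAction (probe a i))))
  have hcons : Consistent f e a (probe a) r ϑ := by
    refine ⟨hϑa, fun i => ?_⟩
    have := hr i
    rwa [hϑ.meanReward_eq, coe_toAction (norm_probe_le ha i)] at this
  have hex : ∃ u : Param d, Consistent f e a (probe a) r (u : Vec d) :=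
    ⟨⟨ϑ, by simpa using hϑ.norm_eq⟩, hcons⟩
  refine (err_ret_of ?_).le
  rw [decode, dif_pos hex]
  exact one_sub_inner_le_of_consistent h ha (norm_param _) hϑ.norm_eq hex.choose_spec hcons

end Learn

/-! ### The signal, the correlation levels and the burn-in integral -/

lemma signal_mono (f : ℝ → ℝ) (b : ℝ) : Monotone (signal f b) := fun _ _ h =>
  biSup_mono fun _ hy => ⟨hy.1, hy.2.trans h⟩

/-- The supremum in `signal` may be infinite or not attained, so a window is chosen for a smaller
real `t`: half of `S`, or `1` when `S > 2`. The loss is the factor `2` and the summand `1`. -/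
lemma exists_lt_of_ne_zero {S : ℝ≥0∞} (hS : S ≠ 0) :
    ∃ t : ℝ, 0 < t ∧ ENNReal.ofReal t < S ∧ ENNReal.ofReal (1 / t) ≤ 2 / S + 1 := by
  by_cases hT : 2 < S
  · exact ⟨1, one_pos, by rw [ENNReal.ofReal_one]; exact lt_trans (by norm_num) hT, by simp⟩
  · have htop : S ≠ ⊤ := fun h => hT (by rw [h]; simp)
    have hr : 0 < S.toReal := ENNReal.toReal_pos hS htop
    refine ⟨S.toReal / 2, by positivity, ?_, ?_⟩
    · rw [ENNReal.ofReal_lt_iff_lt_toReal (by positivity) htop]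
      linarith
    · rw [one_div_div, ENNReal.ofReal_div_of_pos hr, ENNReal.ofReal_toReal htop,
        ENNReal.ofReal_ofNat]
      exact le_self_add

lemma exists_steepOn {f : ℝ → ℝ} (hf : MonotoneOn f (Icc 0 1)) {b x : ℝ} (hb : 0 < b)
    (hx : x < 1) (hS : signal f b x ≠ 0) :
    ∃ y ∈ Icc b x, ∃ s, 0 < s ∧ SteepOn f y s ∧
      ENNReal.ofReal (1 / s ^ 2) ≤ 2 / signal f b x + 1 := by
  obtain ⟨t, ht0, ht, hle⟩ := exists_lt_of_ne_zero hS
  obtain ⟨y, hy⟩ := lt_iSup_iff.1 ht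
  obtain ⟨hyb, hy⟩ := lt_iSup_iff.1 hy
  -- The signal controls only the square of the derivative; monotonicity of `f` supplies the sign.
  have hder : ∀ z ∈ Icc (y / 2) y, √t ≤ deriv f z := by
    intro z hz
    have h1 : ENNReal.ofReal t < ENNReal.ofReal (deriv f z ^ 2) := hy.trans_le (iInf₂_le z hz)
    have h2 := (ENNReal.ofReal_lt_ofReal_iff_of_nonneg ht0.le).1 h1
    have h3 : 0 ≤ deriv f z := by
      rw [← derivWithin_of_mem_nhds (Icc_mem_nhds (a := 0) (b := 1)
        (by linarith [hz.1, hyb.1]) (by linarith [hz.2, hyb.2]))]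
      exact hf.derivWithin_nonneg
    exact Real.sqrt_le_iff.2 ⟨h3, h2.le⟩
  have hs : 0 < √t := Real.sqrt_pos.2 ht0
  refine ⟨y, hyb, √t, hs, fun u u' h1 h2 h3 => ?_, by rwa [Real.sq_sqrt ht0.le]⟩
  have hdiff : ∀ z ∈ Icc (y / 2) y, DifferentiableAt ℝ f z := fun z hz =>
    differentiableAt_of_deriv_ne_zero (hs.trans_le (hder z hz)).ne'
  exact (convex_Icc (y / 2) y).mul_sub_le_image_sub_of_le_deriv
    (fun z hz => (hdiff z hz).continuousAt.continuousWithinAt)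
    (fun z hz => (hdiff z (interior_subset hz)).differentiableWithinAt)
    (fun z hz => hder z (interior_subset hz)) u' ⟨h1, h2.trans h3⟩ u ⟨h1.trans h2, h3⟩ h2

lemma lintegral_Ioc_two_mul {α β : ℝ} (h0 : 0 ≤ α) (h : α ≤ β) :
    ∫⁻ x in Ioc α β, ENNReal.ofReal (2 * x) = ENNReal.ofReal (β ^ 2 - α ^ 2) := by
  rw [← ofReal_integral_eq_lintegral_ofReal]
  · rw [← intervalIntegral.integral_of_le h, intervalIntegral.integral_const_mul, integral_id]
    congr 1
    ring
  · exact (Continuous.integrableOn_Icc (by fun_prop)).mono_set Ioc_subset_Icc_self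
  · filter_upwards [ae_restrict_mem measurableSet_Ioc] with x hx
    have : 0 ≤ x := h0.trans hx.1.le
    simp only [Pi.zero_apply]
    positivity

/-- The correlation levels of the burn-in period. -/
noncomputable def level (d j : ℕ) : ℝ := √(j / (256 * d))

lemma level_sq (d j : ℕ) : level d j ^ 2 = j / (256 * d) := Real.sq_sqrt (by positivity)

lemma level_mono (d : ℕ) : Monotone (level d) := fun i j h =>
  Real.sqrt_le_sqrt (div_le_div_of_nonneg_right (by exact_mod_cast h) (by positivity))

lemma level_pos {d j : ℕ} (hd : 1 ≤ d) (hj : 1 ≤ j) : 0 < level d j :=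
  Real.sqrt_pos.2 (by positivity)

lemma level_eq_div (d j : ℕ) : level d j = √j / (16 * √d) := by
  rw [level, Real.sqrt_div (by positivity), Real.sqrt_mul (by norm_num)]
  norm_num

lemma level_top {d : ℕ} (hd : 1 ≤ d) : level d (64 * d) = 1 / 2 := by
  have hd' : (d : ℝ) ≠ 0 := by positivity
  rw [level, Real.sqrt_eq_iff_mul_self_eq (by positivity) (by norm_num)]
  push_cast
  field_simp
  norm_num

/-- Consecutive squared levels differ by `1/(256 d)`, and `1 / signal` is antitone, so its value at
the right end of each interval bounds the integral there from below. -/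
lemma sum_inv_signal_le (f : ℝ → ℝ) (b : ℝ) (d k : ℕ) :
    ∑ i ∈ Finset.range k, ENNReal.ofReal (1 / (256 * d)) / signal f b (level d (i + 4)) ≤
      ∫⁻ x in Ioc (level d 3) (level d (k + 3)), ENNReal.ofReal (2 * x) / signal f b x := by
  induction k with
  | zero => simp
  | succ k ih =>
    have h1 : level d 3 ≤ level d (k + 3) := level_mono d (by omega)
    have h2 : level d (k + 3) ≤ level d (k + 4) := level_mono d (by omega)
    rw [Finset.sum_range_succ, show k + 1 + 3 = k + 4 by ring, ← Ioc_union_Ioc_eq_Ioc h1 h2,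
      lintegral_union measurableSet_Ioc (Ioc_disjoint_Ioc_of_le le_rfl)]
    refine add_le_add ih ?_
    have h3 : (1 : ℝ) / (256 * d) = level d (k + 4) ^ 2 - level d (k + 3) ^ 2 := by
      rw [level_sq, level_sq, ← sub_div]
      push_cast
      ring
    rw [h3, ← lintegral_Ioc_two_mul (α := level d (k + 3)) (Real.sqrt_nonneg _) h2, div_eq_mul_inv,
      ← lintegral_mul_const _ (by fun_prop)]
    refine setLIntegral_mono' measurableSet_Ioc fun x hx => ?_
    rw [div_eq_mul_inv]
    gcongr
    exact signal_mono f b hx.2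

/-- The constant `c = 3/256` puts the lower limit of the integral one level below the level `4` of
the first action, so that the first summand also has an interval to its left. -/
lemma burnIn_level (d : ℕ) : √((3 / 256 : ℝ) / d) = level d 3 := by
  rw [level, div_div]
  norm_num

lemma sum_div_signal_le {d : ℕ} (hd : 1 ≤ d) (f : ℝ → ℝ) :
    ∑ i ∈ Finset.range (64 * d - 4), (d : ℝ≥0∞) / signal f (level d 3) (level d (i + 4)) ≤
      256 * burnInIntegral f d (3 / 256) := by
  have hd' : (0 : ℝ) < d := by positivity
  have h := sum_inv_signal_le f (level d 3) d (64 * d - 4)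
  have hsub : Ioc (level d 3) (level d (64 * d - 4 + 3)) ⊆ Icc (level d 3) (1 / 2) := by
    refine Ioc_subset_Icc_self.trans (Icc_subset_Icc le_rfl ?_)
    rw [← level_top hd]
    exact level_mono d (by omega)
  have h2 := h.trans (lintegral_mono_set hsub)
  rw [burnInIntegral, burnIn_level]
  calc _ = 256 * ((d : ℝ≥0∞) ^ 2 * ∑ i ∈ Finset.range (64 * d - 4),
          ENNReal.ofReal (1 / (256 * d)) / signal f (level d 3) (level d (i + 4))) := by
        rw [Finset.mul_sum, Finset.mul_sum]
        refine Finset.sum_congr rfl fun i _ => ?_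
        rw [div_eq_mul_inv, div_eq_mul_inv, ← mul_assoc, ← mul_assoc]
        congr 1
        rw [← ENNReal.ofReal_natCast, ← ENNReal.ofReal_pow (by positivity),
          ← ENNReal.ofReal_ofNat, ← ENNReal.ofReal_mul (by positivity),
          ← ENNReal.ofReal_mul (by positivity)]
        congr 1
        field_simp
    _ ≤ _ := by gcongr

/-! ### Sample sizes, failure probabilities and round counts -/

/-- The number of rounds after which an average reward has accuracy `e`, except with probability
`2 / W ^ 20`. -/
noncomputable def sampleSize (W e : ℝ) : ℕ := ⌈160 * Real.log W / e ^ 2⌉₊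

lemma sampleSize_le {W e : ℝ} (hW : 1 ≤ W) :
    (sampleSize W e : ℝ) ≤ 160 * Real.log W / e ^ 2 + 1 :=
  (Nat.ceil_lt_add_one (by have := Real.log_nonneg hW; positivity)).le

lemma exp_neg_log_mul {W : ℝ} (hW : 0 < W) (k : ℕ) :
    Real.exp (-(k * Real.log W)) = 1 / W ^ k := by
  rw [Real.exp_neg, Real.exp_nat_mul, Real.exp_log hW, one_div]

lemma err_average_sampleSize_le {d : ℕ} {N W e : ℝ} {m : Action d → ℝ} (hN : 0 < N) (hW : 1 < W)
    (he0 : 0 < e) (he : 2 ≤ N * e) (a : Action d) :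
    err N m (average N a (sampleSize W e)) (fun r => |r - m a| ≤ e) ≤
      ENNReal.ofReal (2 / W ^ 20) := by
  have hlog := Real.log_pos hW
  have hle := Nat.le_ceil (160 * Real.log W / e ^ 2)
  rw [div_le_iff₀ (by positivity)] at hle
  refine (err_average_le hN a (Nat.ceil_pos.2 (by positivity)) he).trans
    (ENNReal.ofReal_le_ofReal ?_)
  rw [div_eq_mul_one_div 2 (W ^ 20), ← exp_neg_log_mul (by linarith)]
  gcongr
  push_cast
  linarith

lemma three_quarters_pow_le {W : ℝ} (hW : 1 ≤ W) :
    (3 / 4 : ℝ) ^ ⌈12 * Real.log W⌉₊ ≤ 1 / W ^ 3 := by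
  have h1 : (3 / 4 : ℝ) ≤ Real.exp (-(1 / 4)) := by
    have := Real.add_one_le_exp (-(1 / 4 : ℝ))
    linarith
  have h2 := Nat.le_ceil (12 * Real.log W)
  calc (3 / 4 : ℝ) ^ ⌈12 * Real.log W⌉₊ ≤ Real.exp (-(1 / 4)) ^ ⌈12 * Real.log W⌉₊ := by gcongr
    _ = Real.exp (⌈12 * Real.log W⌉₊ * (-(1 / 4))) := (Real.exp_nat_mul _ _).symm
    _ ≤ Real.exp (-((3 : ℕ) * Real.log W)) := by
        gcongr
        push_cast
        linarith
    _ = _ := exp_neg_log_mul (by linarith) 3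

lemma ninety_nine_pow_le {W : ℝ} (hW : 1 ≤ W) :
    (99 / 100 : ℝ) ^ ⌈1000 * Real.log W⌉₊ ≤ 1 / W ^ 10 := by
  have h1 : (99 / 100 : ℝ) ≤ Real.exp (-(1 / 100)) := by
    have := Real.add_one_le_exp (-(1 / 100 : ℝ))
    linarith
  have h2 := Nat.le_ceil (1000 * Real.log W)
  calc (99 / 100 : ℝ) ^ ⌈1000 * Real.log W⌉₊
      ≤ Real.exp (-(1 / 100)) ^ ⌈1000 * Real.log W⌉₊ := by gcongr
    _ = Real.exp (⌈1000 * Real.log W⌉₊ * (-(1 / 100))) := (Real.exp_nat_mul _ _).symm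
    _ ≤ Real.exp (-((10 : ℕ) * Real.log W)) := by
        gcongr
        push_cast
        linarith
    _ = _ := exp_neg_log_mul (by linarith) 10

lemma one_le_log_of_four_le {W : ℝ} (hW : 4 ≤ W) : 1 ≤ Real.log W := by
  rw [Real.le_log_iff_exp_le (by linarith)]
  linarith [Real.exp_one_lt_d9]

lemma log_le_self_of_four_le {W : ℝ} (hW : 4 ≤ W) : Real.log W ≤ W := by
  linarith [Real.log_le_sub_one_of_pos (by linarith : 0 < W)]

/-- The union bound runs over polynomially many tests in `W`, which the failure probability `2/W²⁰`
of a single average absorbs; it also keeps the failure probability of a trial below `99/100`. -/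
lemma burnIn_failure_le {W δ : ℝ} (hW : 4 ≤ W) {d : ℕ} (hd : (d : ℝ) ≤ W) (hδ : 1 / W ≤ δ)
    {k M L : ℕ} (hk : k + 1 ≤ 64 * d) (hM : (M : ℝ) ≤ 1001 * W) (hL : (L : ℝ) ≤ 13 * W)
    (hpow : (99 / 100 : ℝ) ^ M ≤ 1 / W ^ 10) :
    (k + 1 : ℕ) * (M * (L * (2 * ENNReal.ofReal (2 / W ^ 20))) +
      (ENNReal.ofReal (49 / 50) + 2 * ENNReal.ofReal (2 / W ^ 20)) ^ M) ≤ ENNReal.ofReal δ := by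
  have hW0 : 0 < W := by linarith
  have h20 : 4 / W ^ 20 ≤ 1 / 100 := by
    rw [div_le_div_iff₀ (by positivity) (by norm_num)]
    have : (4 : ℝ) ^ 20 ≤ W ^ 20 := by gcongr
    norm_num at this
    linarith
  have hk' : ((k + 1 : ℕ) : ℝ) ≤ 64 * W := by
    calc ((k + 1 : ℕ) : ℝ) ≤ ((64 * d : ℕ) : ℝ) := by exact_mod_cast hk
      _ ≤ 64 * W := by push_cast; linarith
  have h2 : (2 : ℝ≥0∞) * ENNReal.ofReal (2 / W ^ 20) = ENNReal.ofReal (4 / W ^ 20) := by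
    rw [← ENNReal.ofReal_ofNat, ← ENNReal.ofReal_mul (by norm_num)]
    congr 1
    ring
  rw [h2, ← ENNReal.ofReal_add (by norm_num) (by positivity), ← ENNReal.ofReal_pow (by positivity),
    ← ENNReal.ofReal_natCast L, ← ENNReal.ofReal_natCast M, ← ENNReal.ofReal_natCast (k + 1),
    ← ENNReal.ofReal_mul (by positivity), ← ENNReal.ofReal_mul (by positivity),
    ← ENNReal.ofReal_add (by positivity) (by positivity), ← ENNReal.ofReal_mul (by positivity)]
  refine ENNReal.ofReal_le_ofReal (le_trans ?_ hδ)
  calc ((k + 1 : ℕ) : ℝ) * (M * (L * (4 / W ^ 20)) + (49 / 50 + 4 / W ^ 20) ^ M)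
      ≤ 64 * W * (1001 * W * (13 * W * (4 / W ^ 20)) + 1 / W ^ 10) := by
        gcongr
        refine le_trans ?_ hpow
        gcongr
        linarith
    _ = (64 * 1001 * 13 * 4 * (1 / W ^ 16) + 64 * (1 / W ^ 8)) * (1 / W) := by
        field_simp
    _ ≤ 1 * (1 / W) := by
        gcongr
        have h16 : 1 / W ^ 16 ≤ 1 / (4 : ℝ) ^ 16 := by gcongr
        have h8 : 1 / W ^ 8 ≤ 1 / (4 : ℝ) ^ 8 := by gcongr
        norm_num at h16 h8 ⊢
        linarith
    _ = 1 / W := one_mul _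

/-- The three powers of `Λ` come from the number of trials, the number of scales and the sample
size. The rounds spent on coins and on rounding up are of order `d²` up to logarithms, and the
samples of the first stage are charged to the first climbing step. -/
lemma burnIn_rounds_le {Λ I : ℝ} (hΛ : 1 ≤ Λ) (hI : 0 ≤ I) {d k M L : ℕ} (hd : 1 ≤ d)
    (hk1 : 1 ≤ k) (hk : k + 1 ≤ 64 * d) (hM : (M : ℝ) ≤ 1001 * Λ) (hL1 : 1 ≤ L)
    (hL : (L : ℝ) ≤ 13 * Λ) {A : ℝ} (hA : 0 ≤ A) {n : ℕ → ℕ} {s : ℕ → ℝ}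
    (hn : ∀ i < k, (n i : ℝ) ≤ A * Λ * (d * (1 / s i ^ 2)) + 1)
    (hs : ∑ i ∈ Finset.range k, d * (1 / s i ^ 2) ≤ 512 * I + 64 * d ^ 2) :
    ((M * (d + n 0) + ∑ i ∈ Finset.range k, M * (d + L * (n i + n i)) : ℕ) : ℝ) ≤
      1001 * (64 + 39 * (512 * A + 64)) * Λ ^ 3 * (I + d ^ 2) := by
  have hd' : (1 : ℝ) ≤ d := by exact_mod_cast hd
  have hk' : (k : ℝ) + 1 ≤ 64 * d := by exact_mod_cast hk
  have hL1' : (1 : ℝ) ≤ L := by exact_mod_cast hL1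
  have hsum : ∑ i ∈ Finset.range k, (n i : ℝ) ≤ A * Λ * (512 * I + 64 * d ^ 2) + 64 * d := by
    calc ∑ i ∈ Finset.range k, (n i : ℝ)
        ≤ ∑ i ∈ Finset.range k, (A * Λ * (d * (1 / s i ^ 2)) + 1) :=
          Finset.sum_le_sum fun i hi => hn i (Finset.mem_range.1 hi)
      _ = A * Λ * ∑ i ∈ Finset.range k, d * (1 / s i ^ 2) + k := by
          rw [Finset.sum_add_distrib, Finset.mul_sum]
          simp
      _ ≤ _ := by gcongr; linarith
  have h0 : (n 0 : ℝ) ≤ ∑ i ∈ Finset.range k, (n i : ℝ) :=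
    Finset.single_le_sum (f := fun i => (n i : ℝ)) (fun i _ => Nat.cast_nonneg _)
      (Finset.mem_range.2 hk1)
  have hS0 : 0 ≤ ∑ i ∈ Finset.range k, (n i : ℝ) := Finset.sum_nonneg fun i _ => Nat.cast_nonneg _
  set S := ∑ i ∈ Finset.range k, (n i : ℝ)
  have hbr : A * Λ * (512 * I + 64 * d ^ 2) + 64 * d ≤ (512 * A + 64) * Λ * (I + d ^ 2) := by
    have h1 : 64 * (d : ℝ) ≤ 64 * (Λ * (I + d ^ 2)) := by nlinarith
    have h2 : 0 ≤ A * Λ * d ^ 2 := by positivity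
    nlinarith
  calc ((M * (d + n 0) + ∑ i ∈ Finset.range k, M * (d + L * (n i + n i)) : ℕ) : ℝ)
      = M * ((k + 1) * d + n 0 + 2 * L * S) := by
        push_cast
        have : ∑ i ∈ Finset.range k, (M : ℝ) * (d + L * (n i + n i)) =
            M * (k * d + 2 * L * S) := by
          rw [← Finset.mul_sum, Finset.sum_add_distrib, Finset.mul_sum]
          simp only [Finset.sum_const, Finset.card_range, nsmul_eq_mul]
          congr 2
          exact Finset.sum_congr rfl fun i _ => by ring
        rw [this]
        ring
    _ ≤ M * (64 * d * d + 3 * L * S) := by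
        refine mul_le_mul_of_nonneg_left ?_ (Nat.cast_nonneg M)
        have h1 : 1 * S ≤ L * S := by gcongr
        have h2 : (k + 1 : ℝ) * d ≤ 64 * d * d := by gcongr
        linarith
    _ ≤ 1001 * Λ * (64 * (Λ ^ 2 * (I + d ^ 2)) +
          3 * (13 * Λ) * ((512 * A + 64) * Λ * (I + d ^ 2))) := by
        gcongr ?_ * (?_ + 3 * ?_ * ?_)
        · have : 1 * (d : ℝ) ^ 2 ≤ Λ ^ 2 * (I + d ^ 2) := by
            gcongr
            · nlinarith
            · linarith
          nlinarith
        · linarith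
    _ = _ := by ring

/-! ### The burn-in theorem -/

theorem exists_burnIn : ∃ C : ℝ, 0 < C ∧ ∀ (d : ℕ) (f : ℝ → ℝ) (δ : ℝ), 1 ≤ d →
    BurnInRegular f → 0 < δ → δ ≤ 1 → burnInIntegral f d (3 / 256) ≠ ⊤ →
    ∃ N₀ : ℝ, ∀ N : ℝ, 0 < N → N₀ ≤ N → ∃ (p : Prog d (Vec d)) (n : ℕ),
      Within (fun _ => True) n p ∧
      (n : ℝ) ≤ C * Real.log (2 + d + 1 / δ) ^ 3 *
        ((burnInIntegral f d (3 / 256)).toReal + d ^ 2) ∧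
      ∀ θ : Param d, err N (meanReward f θ) p
        (fun a => ‖a‖ = 1 ∧ ∃ ϑ, SameRewards f θ ϑ ∧ 1 / 2 ≤ ⟪ϑ, a⟫_ℝ) ≤ ENNReal.ofReal δ := by
  refine ⟨1001 * (64 + 39 * (512 * (160 * (9 * 960 ^ 2)) + 64)), by positivity, ?_⟩
  intro d f δ hd hf hδ0 hδ1 hI
  have hd' : (1 : ℝ) ≤ d := by exact_mod_cast hd
  have hsd : 0 < √(d : ℝ) := Real.sqrt_pos.2 (by linarith)
  set k := 64 * d - 4 with hk
  have hk4 : k + 4 = 64 * d := by omega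
  set W : ℝ := 2 + d + 1 / δ with hW
  have hδW : 1 ≤ 1 / δ := by rw [le_div_iff₀ hδ0]; linarith
  have hW4 : 4 ≤ W := by linarith
  have hdW : (d : ℝ) ≤ W := by linarith
  have hWδ : 1 / W ≤ δ := by
    rw [div_le_iff₀ (by linarith), mul_comm, ← div_le_iff₀ hδ0]
    linarith
  have hΛ := one_le_log_of_four_le hW4
  have hΛW := log_le_self_of_four_le hW4
  set Λ := Real.log W with hΛdef
  set x : ℕ → ℝ := fun i => level d (i + 4) with hx
  have hxhalf : ∀ i ≤ k, x i ≤ 1 / 2 := fun i hi => by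
    rw [← level_top hd]
    exact level_mono d (by omega)
  have hsum := sum_div_signal_le hd f
  rw [← hk] at hsum
  have hsig0 : signal f (level d 3) (x 0) ≠ 0 := by
    intro h
    apply hI
    have h1 : (d : ℝ≥0∞) / signal f (level d 3) (x 0) ≤ 256 * burnInIntegral f d (3 / 256) :=
      (Finset.single_le_sum (f := fun i => (d : ℝ≥0∞) / signal f (level d 3) (level d (i + 4)))
        (fun i _ => zero_le) (Finset.mem_range.2 (by omega : 0 < k))).trans hsum
    rw [h, ENNReal.div_zero (by exact_mod_cast (by omega : d ≠ 0)), top_le_iff] at h1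
    by_contra hne
    exact ENNReal.mul_ne_top (by norm_num) hne h1
  have hex : ∀ i, ∃ y s : ℝ, i ≤ k → y ∈ Icc (level d 3) (x i) ∧ 0 < s ∧ SteepOn f y s ∧
      ENNReal.ofReal (1 / s ^ 2) ≤ 2 / signal f (level d 3) (x i) + 1 := by
    intro i
    by_cases hi : i ≤ k
    · have hne : signal f (level d 3) (x i) ≠ 0 := by
        intro h
        apply hsig0
        rw [← nonpos_iff_eq_zero, ← h]
        exact signal_mono f _ (level_mono d (by omega))
      obtain ⟨y, hy, s, hs⟩ := exists_steepOn hf.monotoneOn (level_pos hd (by norm_num))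
        (by linarith [hxhalf i hi]) hne
      exact ⟨y, s, fun _ => ⟨hy, hs⟩⟩
    · exact ⟨0, 0, fun h => absurd h hi⟩
  choose y s hys using hex
  -- With `μ = 1/80`, a good direction shifts the argument by at least `μ/(4√d) = 3η` and at most
  -- `48η`, which is at most `y/2` since `y ≥ 96η`. The guaranteed gain `η/μ` exceeds `g =
  -- 1/(16√d)`, which is exactly one level.
  set η : ℝ := 1 / (960 * √d) with hη
  have hη0 : 0 < η := by positivity
  have hbase : 1 / (10 * √d) ≤ level d 3 := by
    rw [level_eq_div, div_le_div_iff₀ (by positivity) (by positivity)]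
    have : (8 / 5 : ℝ) ≤ √((3 : ℕ) : ℝ) := Real.le_sqrt_of_sq_le (by norm_num)
    generalize √((3 : ℕ) : ℝ) = q at this ⊢
    nlinarith
  have hyη : ∀ i ≤ k, 96 * η ≤ y i := fun i hi => by
    have h1 := hbase.trans (hys i hi).1.1
    have h2 : 96 * η = 1 / (10 * √d) := by rw [hη]; field_simp; norm_num
    linarith
  set e : ℕ → ℝ := fun i => s i * η / 3 with he
  have he0 : ∀ i ≤ k, 0 < e i := fun i hi => by
    have := (hys i hi).2.1
    positivity
  set M := ⌈1000 * Λ⌉₊ with hM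
  set L := ⌈12 * Λ⌉₊ with hL
  have hMΛ : (M : ℝ) ≤ 1001 * Λ := by
    have := Nat.ceil_lt_add_one (by positivity : 0 ≤ 1000 * Λ)
    linarith
  have hLΛ : (L : ℝ) ≤ 13 * Λ := by
    have := Nat.ceil_lt_add_one (by positivity : 0 ≤ 12 * Λ)
    linarith
  have hL1 : 1 ≤ L := Nat.ceil_pos.2 (by positivity)
  -- A sum of positive terms bounds each of them, so this grid is fine enough for every accuracy in
  -- use.
  refine ⟨∑ i ∈ Finset.range (k + 1), 2 / e i, fun N hN hN₀ => ?_⟩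
  have hNe : ∀ i ≤ k, 2 ≤ N * e i := fun i hi => by
    have h1 : 2 / e i ≤ ∑ i ∈ Finset.range (k + 1), 2 / e i :=
      Finset.single_le_sum (f := fun i => 2 / e i)
        (fun j hj => (div_pos two_pos (he0 j (by have := Finset.mem_range.1 hj; omega))).le)
        (Finset.mem_range.2 (by omega))
    rw [← div_le_iff₀ (he0 i hi)]
    exact h1.trans hN₀
  refine ⟨climb f N (1 / (16 * √d)) η (1 / 80) x y e d (fun i => sampleSize W (e i)) L M k, _,
    within_climb _ _ _ _ _ _ _ _ _ _ _ _ _, ?_, fun θ => ?_⟩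
  · refine burnIn_rounds_le (A := 160 * (9 * 960 ^ 2))
      (n := fun i => sampleSize W (e i)) (s := s) hΛ ENNReal.toReal_nonneg hd (by omega) (by omega) hMΛ hL1 hLΛ
      (by positivity) (fun i hi => ?_) ?_
    · refine (sampleSize_le (by linarith)).trans_eq ?_
      have h1 := (hys i hi.le).2.1
      have h2 : √(d : ℝ) ^ 2 = d := Real.sq_sqrt (by linarith)
      have h3 : e i ^ 2 = s i ^ 2 / (9 * 960 ^ 2 * d) := by
        rw [← h2, he, hη]
        field_simp
        norm_num
      rw [h3, ← hΛdef]
      field_simp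
    · have h1 : ∑ i ∈ Finset.range k, ENNReal.ofReal (d * (1 / s i ^ 2)) ≤
          512 * burnInIntegral f d (3 / 256) + 64 * (d : ℝ≥0∞) ^ 2 := by
        calc ∑ i ∈ Finset.range k, ENNReal.ofReal (d * (1 / s i ^ 2))
            ≤ ∑ i ∈ Finset.range k,
                (2 * ((d : ℝ≥0∞) / signal f (level d 3) (level d (i + 4))) + d) := by
              refine Finset.sum_le_sum fun i hi => ?_
              rw [ENNReal.ofReal_mul (by positivity), ENNReal.ofReal_natCast]
              refine (mul_le_mul' (le_refl (d : ℝ≥0∞))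
                (hys i (Finset.mem_range.1 hi).le).2.2.2).trans_eq ?_
              rw [mul_add, mul_one, div_eq_mul_inv, div_eq_mul_inv]
              ring
          _ = 2 * ∑ i ∈ Finset.range k,
                ((d : ℝ≥0∞) / signal f (level d 3) (level d (i + 4))) + k * d := by
              rw [Finset.sum_add_distrib, Finset.mul_sum]
              simp
          _ ≤ 2 * (256 * burnInIntegral f d (3 / 256)) + (64 * d : ℕ) * d := by
              gcongr
              omega
          _ = _ := by push_cast; ring
      rw [← ENNReal.ofReal_sum_of_nonneg fun i _ => by positivity] at h1
      have h2 : (512 * burnInIntegral f d (3 / 256) + 64 * (d : ℝ≥0∞) ^ 2 : ℝ≥0∞) =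
          ENNReal.ofReal (512 * (burnInIntegral f d (3 / 256)).toReal + 64 * d ^ 2) := by
        rw [ENNReal.ofReal_add (by positivity) (by positivity), ENNReal.ofReal_mul (by positivity),
          ENNReal.ofReal_mul (by positivity), ENNReal.ofReal_toReal hI,
          ENNReal.ofReal_pow (by positivity)]
        simp
      rw [h2] at h1
      exact (ENNReal.ofReal_le_ofReal_iff (by positivity)).1 h1
  · have hxk : x k = 1 / 2 := by
      rw [hx]
      simp only [hk4]
      exact level_top hd
    rw [← hxk]
    refine (err_climb_le (s := s) hd hN hf hη0 ?_ (by norm_num) (by norm_num) (by positivity) ?_ hL1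
      ?_ hxhalf ?_ (fun i hi => (hys i hi).1.2)
      (fun i hi => by linarith [hyη i hi]) (fun i hi => (hys i hi).2.2.1) ?_ ?_ ?_ ?_ ?_
      (fun i hi a => err_average_sampleSize_le hN (by linarith) (he0 i hi) (hNe i hi) a)).trans
      (burnIn_failure_le hW4 hdW hWδ (by omega) (by linarith) (by linarith)
        (ninety_nine_pow_le (by linarith)))
    · rw [hη]
      refine le_of_eq ?_
      field_simp
      norm_num
    · rw [hη]
      have : 1 / (16 * √(d : ℝ)) * (1 / 80) = 3 / 4 * (1 / (960 * √d)) := by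
        field_simp
        norm_num
      rw [this]
      linarith
    · have h4 : √((4 : ℕ) : ℝ) = 2 := by
        rw [Real.sqrt_eq_iff_mul_self_eq (by norm_num) (by norm_num)]
        norm_num
      have h0 : x 0 = 2 / (16 * √d) := by rw [hx]; simp only [zero_add, level_eq_div, h4]
      rw [h0]
      refine le_of_eq ?_
      field_simp
      norm_num
    · intro i _
      simp only [hx]
      rw [level_sq, level, div_pow, mul_pow, Real.sq_sqrt (by linarith)]
      congr 1
      push_cast
      field_simp
      ring
    · intro i hi
      have := he0 i hi
      simp only [he] at this ⊢
      linarith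
    · intro i hi
      linarith [hyη i hi]
    · intro i hi
      have h1 : 1 / 80 * (4 / √(d : ℝ)) = 48 * η := by
        rw [hη]
        field_simp
        norm_num
      linarith [hyη i hi]
    · intro i hi
      refine (three_quarters_pow_le (by linarith)).trans (le_trans ?_ (hbase.trans (hys i hi).1.1))
      gcongr
      have h1 : √(d : ℝ) ≤ d := by
        rw [Real.sqrt_le_left (by linarith)]
        nlinarith
      nlinarith [mul_le_mul hW4 hW4 (by norm_num) (by linarith : (0 : ℝ) ≤ W)]
    · have h1 := hyη 0 (by omega)
      have h2 := (hys 0 (by omega)).2.1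
      simp only [he]
      nlinarith [mul_pos h2 hη0]

/-! ### Bounds on instantaneous regret and estimation loss -/

section Regret

variable {d : ℕ} {f : ℝ → ℝ}

lemma BurnInRegular.abs_meanReward_le (hf : BurnInRegular f) (θ : Param d) (a : Action d) :
    |meanReward f θ a| ≤ 1 :=
  hf.bounded _ (abs_le.1 (abs_inner_le_one (norm_param θ) (norm_action_le a)))

lemma BurnInRegular.bddAbove (hf : BurnInRegular f) (θ : Param d) :
    BddAbove (Set.range (meanReward f θ)) :=
  ⟨1, by rintro _ ⟨a, rfl⟩; exact (abs_le.1 (hf.abs_meanReward_le θ a)).2⟩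

lemma BurnInRegular.instantRegret_nonneg (hf : BurnInRegular f) (θ : Param d) (a : Action d) :
    0 ≤ instantRegret f θ a :=
  sub_nonneg.2 (le_ciSup (hf.bddAbove θ) a)

lemma BurnInRegular.instantRegret_le (hf : BurnInRegular f) (θ : Param d) (a : Action d) :
    instantRegret f θ a ≤ 1 - meanReward f θ a := by
  have : Nonempty (Action d) := ⟨zeroAction d⟩
  exact sub_le_sub_right (ciSup_le fun a => (abs_le.1 (hf.abs_meanReward_le θ a)).2) _

lemma BurnInRegular.instantRegret_le_two (hf : BurnInRegular f) (θ : Param d) (a : Action d) :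
    instantRegret f θ a ≤ 2 := by
  have := hf.instantRegret_le θ a
  linarith [(abs_le.1 (hf.abs_meanReward_le θ a)).1]

lemma instantRegret_le_mul (hf : BurnInRegular f) {cf Cf : ℝ} (hl : LearningRegular f cf Cf)
    {θ : Param d} {ϑ : Vec d} (hϑ : SameRewards f θ ϑ) {w : Vec d} (hw : ‖w‖ ≤ 1)
    (hϑw : 1 / 10 ≤ ⟪ϑ, w⟫_ℝ) :
    instantRegret f θ (toAction w) ≤ Cf * (1 - ⟪ϑ, w⟫_ℝ) := by
  refine (hf.instantRegret_le θ _).trans ?_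
  rw [hϑ.meanReward_eq, coe_toAction hw]
  have h := (hl.sub_le hϑw (inner_le_one_of_norm_le hϑ.norm_eq hw) le_rfl).2
  rwa [hf.one] at h

lemma LearningRegular.le {cf Cf : ℝ} (hl : LearningRegular f cf Cf) : cf ≤ Cf :=
  (hl.lower 1 (by norm_num)).trans (hl.upper 1 (by norm_num))

/-- Over `[1/10, 1]`, of length `9/10`, `f` rises by at most `1`. This lets `d² / (cf² ε)` absorb
the `d²` rounds of the burn-in. -/
lemma LearningRegular.le_ten_ninths (hf : BurnInRegular f) {cf Cf : ℝ}
    (hl : LearningRegular f cf Cf) : cf ≤ 10 / 9 := by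
  have h := (hl.sub_le (x := 1 / 10) (y := 1) le_rfl (by norm_num) le_rfl).1
  have h0 := hf.monotoneOn (a := 0) (b := 1 / 10) (by norm_num) (by norm_num) (by norm_num)
  rw [hf.zero] at h0
  rw [hf.one] at h
  linarith

lemma estimationLoss_le {θ u : Param d} {ϑ : Vec d} (hϑ : SameRewards f θ ϑ) :
    estimationLoss f u θ ≤ 1 - ⟪(u : Vec d), ϑ⟫_ℝ := by
  rw [estimationLoss]
  rcases hϑ with rfl | ⟨he, rfl⟩
  · split_ifs
    · exact sub_le_sub_left (le_abs_self _) _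
    · exact le_rfl
  · rw [if_pos he, inner_neg_right]
    exact sub_le_sub_left (neg_le_abs _) _

lemma estimationLoss_le_two (f : ℝ → ℝ) (θ u : Param d) : estimationLoss f u θ ≤ 2 := by
  refine (estimationLoss_le (Or.inl rfl)).trans ?_
  linarith [(abs_le.1 (abs_inner_le_one (norm_param u) (norm_param θ).le)).1]

end Regret

/-! ### The learning theorem and the sample complexity -/

theorem exists_learn : ∃ C : ℝ, 0 < C ∧ ∀ (d : ℕ) (f : ℝ → ℝ) (cf Cf δ ε : ℝ), 1 ≤ d →
    BurnInRegular f → LearningRegular f cf Cf → 0 < δ → δ ≤ 1 → 0 < ε → ε ≤ 1 / 2 →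
    ∃ N₀ : ℝ, ∀ N : ℝ, 0 < N → N₀ ≤ N → ∃ (q : Vec d → Prog d (Param d)) (n : ℕ),
      (∀ a, Within (fun _ => True) n (q a)) ∧
      (n : ℝ) ≤ C * Real.log (2 + d + 1 / δ) * (d ^ 2 / (cf ^ 2 * ε)) ∧
      ∀ (θ : Param d) (a ϑ : Vec d), SameRewards f θ ϑ → ‖a‖ = 1 → 1 / 2 ≤ ⟪ϑ, a⟫_ℝ →
        Within (fun a => instantRegret f θ a ≤ Cf) n (q a) ∧
        err N (meanReward f θ) (q a) (fun u => 1 - ⟪(u : Vec d), ϑ⟫_ℝ ≤ ε) ≤ ENNReal.ofReal δ := by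
  refine ⟨128002, by norm_num, ?_⟩
  intro d f cf Cf δ ε hd hf hl hδ0 hδ1 hε0 hε1
  have hcf := hl.pos
  have hcf1 := LearningRegular.le_ten_ninths hf hl
  have hd' : (1 : ℝ) ≤ d := by exact_mod_cast hd
  set W : ℝ := 2 + d + 1 / δ with hW
  have hδW : 1 ≤ 1 / δ := by rw [le_div_iff₀ hδ0]; linarith
  have hW4 : 4 ≤ W := by linarith
  have hW0 : 0 < W := by linarith
  have hWδ : 1 / W ≤ δ := by
    rw [div_le_iff₀ hW0, mul_comm, ← div_le_iff₀ hδ0]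
    linarith
  have hΛ := one_le_log_of_four_le hW4
  set e : ℝ := cf * √(ε / (400 * d)) with he
  have hs0 : 0 < √(ε / (400 * d)) := Real.sqrt_pos.2 (by positivity)
  have he0 : 0 < e := by positivity
  have he2 : e ^ 2 = cf ^ 2 * (ε / (400 * d)) := by
    rw [he, mul_pow, Real.sq_sqrt (by positivity)]
  have hacc : d * (400 * (e / cf) ^ 2) = ε := by
    rw [div_pow, he2]
    field_simp
  refine ⟨2 / e, fun N hN hN₀ => ?_⟩
  have hNe : 2 ≤ N * e := by rwa [div_le_iff₀ he0] at hN₀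
  have u₀ : Param d := ⟨signVector fun _ => true, by simpa using norm_signVector hd _⟩
  refine ⟨learn f N e (sampleSize W e) u₀, (d + 1) * sampleSize W e,
    fun a => within_learn _ _ _ _ _ fun _ => trivial, ?_, fun θ a ϑ hϑ ha hϑa =>
      ⟨within_learn _ _ _ _ _ fun i => ?_, ?_⟩⟩
  · have h1 : 1 ≤ Real.log W * (d / (cf ^ 2 * ε)) := by
      have h2 : 1 ≤ d / (cf ^ 2 * ε) := by
        rw [le_div_iff₀ (by positivity)]
        have : cf ^ 2 * ε ≤ (10 / 9) ^ 2 * (1 / 2) := by gcongr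
        norm_num at this
        linarith
      nlinarith
    have h3 : (sampleSize W e : ℝ) ≤ 64001 * (Real.log W * (d / (cf ^ 2 * ε))) := by
      refine (sampleSize_le (by linarith)).trans ?_
      have : 160 * Real.log W / e ^ 2 = 64000 * (Real.log W * (d / (cf ^ 2 * ε))) := by
        rw [he2]
        field_simp
        norm_num
      linarith
    calc (((d + 1) * sampleSize W e : ℕ) : ℝ) = (d + 1) * sampleSize W e := by push_cast; ring
      _ ≤ (2 * d) * (64001 * (Real.log W * (d / (cf ^ 2 * ε)))) := by
          gcongr
          linarith
      _ = _ := by ring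
  · have hp := norm_probe_le ha i
    have hq := inner_probe_ge hϑ.norm_eq hϑa i
    refine (instantRegret_le_mul hf hl hϑ hp hq).trans ?_
    have := hcf.trans_le hl.le
    nlinarith
  · have h := err_learn_le hl u₀ hϑ ha hϑa (fun a =>
      err_average_sampleSize_le (W := W) (m := meanReward f θ) hN (by linarith) he0 hNe a)
    rw [hacc] at h
    refine h.trans ?_
    rw [← ENNReal.ofReal_natCast, ← ENNReal.ofReal_mul (by positivity)]
    refine ENNReal.ofReal_le_ofReal (le_trans ?_ hWδ)
    have hdW : ((d + 1 : ℕ) : ℝ) ≤ W := by push_cast; linarith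
    calc ((d + 1 : ℕ) : ℝ) * (2 / W ^ 20) ≤ W * (2 / W ^ 20) := by gcongr
      _ = (2 / W ^ 18) * (1 / W) := by field_simp
      _ ≤ 1 * (1 / W) := by
          gcongr
          rw [div_le_one (by positivity)]
          have : (4 : ℝ) ^ 18 ≤ W ^ 18 := by gcongr
          norm_num at this
          linarith
      _ = 1 / W := one_mul _

lemma sampleComplexity_le : ∃ K : ℝ, 0 < K ∧ ∀ (d : ℕ) (f : ℝ → ℝ) (cf Cf ε : ℝ), 1 ≤ d →
    BurnInRegular f → LearningRegular f cf Cf → 0 < ε → ε < 1 / 2 →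
    sampleComplexity f d ε ≤ ENNReal.ofReal (K * Real.log (2 + d + 1 / ε) ^ 3) *
      (burnInIntegral f d (3 / 256) + ENNReal.ofReal ((d : ℝ) ^ 2 / (cf ^ 2 * ε))) := by
  obtain ⟨C₁, hC₁, hburn⟩ := exists_burnIn
  obtain ⟨C₂, hC₂, hlearn⟩ := exists_learn
  refine ⟨27 * C₁ + 6 * C₂, by positivity, fun d f cf Cf ε hd hf hl hε0 hε1 => ?_⟩
  have hcf := hl.pos
  have hcf1 := LearningRegular.le_ten_ninths hf hl
  have hd' : (1 : ℝ) ≤ d := by exact_mod_cast hd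
  have hεW : 2 ≤ 1 / ε := by rw [le_div_iff₀ hε0]; linarith
  set W : ℝ := 2 + d + 1 / ε with hW
  have hΛ : 1 ≤ Real.log W := one_le_log_of_four_le (by linarith)
  by_cases hI : burnInIntegral f d (3 / 256) = ⊤
  · rw [hI, top_add, ENNReal.mul_top]
    · exact le_top
    · rw [← pos_iff_ne_zero, ENNReal.ofReal_pos]
      positivity
  -- The loss is at most `2`, so the risk is at most `ε/2 + 2 (ε/8 + ε/8) = ε`.
  obtain ⟨N₁, hN₁⟩ := hburn d f (ε / 8) hd hf (by positivity) (by linarith) hI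
  obtain ⟨N₂, hN₂⟩ := hlearn d f cf Cf (ε / 8) (ε / 2) hd hf hl (by positivity) (by linarith)
    (by positivity) (by linarith)
  set N : ℝ := max (max N₁ N₂) 1
  have hN : 0 < N := lt_of_lt_of_le one_pos (le_max_right _ _)
  obtain ⟨p, n₁, hp, hn₁, hperr⟩ := hN₁ N hN ((le_max_left _ _).trans (le_max_left _ _))
  obtain ⟨q, n₂, hq, hn₂, hqerr⟩ := hN₂ N hN ((le_max_right _ _).trans (le_max_left _ _))
  have u₀ : Param d := ⟨signVector fun _ => true, by simpa using norm_signVector hd _⟩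
  have hlog : Real.log (2 + d + 1 / (ε / 8)) ≤ 3 * Real.log W := by
    have h1 : 1 / (ε / 8) = 8 * (1 / ε) := by field_simp
    rw [h1, show (3 : ℝ) * Real.log W = Real.log (W ^ 3) by rw [Real.log_pow]; norm_num]
    refine Real.log_le_log (by positivity) ?_
    nlinarith [mul_le_mul (by linarith : (4 : ℝ) ≤ W) (by linarith : (4 : ℝ) ≤ W) (by norm_num)
      (by linarith : (0 : ℝ) ≤ W)]
  have hlog0 : 0 ≤ Real.log (2 + d + 1 / (ε / 8)) := Real.log_nonneg (by
    have : 0 ≤ 1 / (ε / 8) := by positivity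
    linarith)
  have hrisk : minimaxRisk f d (n₁ + n₂) ≤ ENNReal.ofReal ε := by
    refine minimaxRisk_le (N := N) hf.measurable_meanReward (hp.bind hq) u₀ fun θ => ?_
    have herr : err N (meanReward f θ) (p.bind q) (fun u => ∃ ϑ, SameRewards f θ ϑ ∧
        1 - ⟪(u : Vec d), ϑ⟫_ℝ ≤ ε / 2) ≤ ENNReal.ofReal (ε / 8) + ENNReal.ofReal (ε / 8) := by
      refine (err_bind_le _ _ ?_).trans (add_le_add (hperr θ) le_rfl)
      rintro a ⟨ha, ϑ, hϑ, hϑa⟩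
      exact (err_mono _ fun u hu => ⟨ϑ, hϑ, hu⟩).trans (hqerr θ a ϑ hϑ ha hϑa).2
    refine (wp_le_add_err (b := ENNReal.ofReal (ε / 2)) (B := ENNReal.ofReal 2) _
      (G := fun u : Param d => ∃ ϑ, SameRewards f θ ϑ ∧ 1 - ⟪(u : Vec d), ϑ⟫_ℝ ≤ ε / 2) ?_
      fun u => ENNReal.ofReal_le_ofReal (estimationLoss_le_two f θ u)).trans ?_
    · rintro u ⟨ϑ, hϑ, hu⟩
      exact ENNReal.ofReal_le_ofReal ((estimationLoss_le hϑ).trans hu)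
    · refine (add_le_add le_rfl (mul_le_mul' le_rfl herr)).trans_eq ?_
      rw [← ENNReal.ofReal_add (by positivity) (by positivity), ← ENNReal.ofReal_mul (by norm_num),
        ← ENNReal.ofReal_add (by positivity) (by positivity)]
      congr 1
      ring
  have hI' : (burnInIntegral f d (3 / 256) : ℝ≥0∞) + ENNReal.ofReal ((d : ℝ) ^ 2 / (cf ^ 2 * ε)) =
      ENNReal.ofReal ((burnInIntegral f d (3 / 256)).toReal + (d : ℝ) ^ 2 / (cf ^ 2 * ε)) := by
    rw [ENNReal.ofReal_add ENNReal.toReal_nonneg (by positivity), ENNReal.ofReal_toReal hI]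
  refine (iInf₂_le (n₁ + n₂) hrisk).trans ?_
  rw [hI', ← ENNReal.ofReal_mul (by positivity), ← ENNReal.ofReal_natCast]
  refine ENNReal.ofReal_le_ofReal ?_
  have hI0 : 0 ≤ (burnInIntegral f d (3 / 256)).toReal := ENNReal.toReal_nonneg
  set I := (burnInIntegral f d (3 / 256)).toReal
  set D := (d : ℝ) ^ 2 / (cf ^ 2 * ε) with hD
  have hdD : (d : ℝ) ^ 2 ≤ D := by
    rw [hD, le_div_iff₀ (by positivity)]
    have : cf ^ 2 * ε ≤ (10 / 9) ^ 2 * (1 / 2) := by gcongr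
    norm_num at this
    nlinarith [sq_nonneg (d : ℝ)]
  have hD2 : (d : ℝ) ^ 2 / (cf ^ 2 * (ε / 2)) = 2 * D := by rw [hD]; field_simp
  have hD0 : 0 ≤ D := by positivity
  rw [hD2] at hn₂
  push_cast
  calc (n₁ : ℝ) + n₂ ≤ C₁ * (3 * Real.log W) ^ 3 * (I + D) +
        C₂ * (3 * Real.log W) * (2 * D) := by
        refine add_le_add (hn₁.trans ?_) (hn₂.trans ?_) <;> gcongr
    _ ≤ 27 * C₁ * Real.log W ^ 3 * (I + D) + 6 * C₂ * (Real.log W ^ 3 * (I + D)) := by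
        have h1 : Real.log W * D ≤ Real.log W ^ 3 * (I + D) := by
          gcongr
          · exact le_self_pow₀ hΛ (by norm_num)
          · linarith
        nlinarith
    _ = _ := by ring

/-! ### The regret bound -/

lemma bind_ret_right {d : ℕ} {α : Type} (p : Prog d α) : p.bind .ret = p := by
  induction p with
  | ret x => rfl
  | play a k ih => simp only [bind_play, ih]

lemma minimaxRegret_le_two_mul {d : ℕ} {f : ℝ → ℝ} (hf : BurnInRegular f) (T : ℕ) :
    minimaxRegret f d T ≤ T * 2 :=
  minimaxRegret_le (N := 1) hf.measurable_meanReward hf.instantRegret_nonneg id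
    (.ret (zeroAction d)) T fun θ => cost_le_mul (fun a => by
      rw [← ENNReal.ofReal_ofNat]
      exact ENNReal.ofReal_le_ofReal (hf.instantRegret_le_two θ a)) T _

lemma minimaxRegret_le_of_lt : ∃ K : ℝ, 0 < K ∧ ∀ (d : ℕ) (f : ℝ → ℝ) (cf Cf : ℝ) (T : ℕ), 1 ≤ d →
    BurnInRegular f → LearningRegular f cf Cf → burnInIntegral f d (3 / 256) ≠ ⊤ →
    Cf / cf * d * √T < T →
    minimaxRegret f d T ≤ ENNReal.ofReal (K * Real.log (2 + d + T) ^ 3 *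
      ((burnInIntegral f d (3 / 256)).toReal + Cf / cf * d * √T)) := by
  obtain ⟨C₁, hC₁, hburn⟩ := exists_burnIn
  obtain ⟨C₂, hC₂, hlearn⟩ := exists_learn
  refine ⟨2 * C₁ + C₂ + 6, by positivity, fun d f cf Cf T hd hf hl hI hDT => ?_⟩
  have hcf := hl.pos
  have hCf := hcf.trans_le hl.le
  have hd' : (1 : ℝ) ≤ d := by exact_mod_cast hd
  have hT : 1 ≤ T := by
    by_contra h
    obtain rfl : T = 0 := by omega
    simp at hDT
  have hT' : (1 : ℝ) ≤ T := by exact_mod_cast hT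
  have hsT : 1 ≤ √(T : ℝ) := Real.one_le_sqrt.2 hT'
  have hsT2 : √(T : ℝ) * √T = T := Real.mul_self_sqrt (by linarith)
  have hI0 : 0 ≤ (burnInIntegral f d (3 / 256)).toReal := ENNReal.toReal_nonneg
  set I := (burnInIntegral f d (3 / 256)).toReal
  set D := Cf / cf * d * √T with hD
  have hratio : 1 ≤ Cf / cf := by rw [le_div_iff₀ hcf]; linarith [hl.le]
  have hdD : d * √(T : ℝ) ≤ D := by
    rw [hD, mul_assoc]
    exact le_mul_of_one_le_left (by positivity) hratio
  -- In the nontrivial regime `D < T` the horizon exceeds `d²`, so `d² ≤ d √T ≤ D` absorbs the extra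
  -- burn-in rounds.
  have hdT : (d : ℝ) ≤ √T := by
    have h : d * √(T : ℝ) < √T * √T := by rw [hsT2]; linarith
    exact (lt_of_mul_lt_mul_right h (by positivity)).le
  have hd2D : (d : ℝ) ^ 2 ≤ D := by nlinarith
  have hD1 : 1 ≤ D := by nlinarith
  have hΛ : 1 ≤ Real.log (2 + d + T) := one_le_log_of_four_le (by linarith)
  -- Failure probability `1/T` costs at most `2T · (1/T) = 2` in expected regret.
  obtain ⟨N₁, hN₁⟩ := hburn d f (1 / T) hd hf (by positivity)
    (by rw [div_le_one (by positivity)]; exact hT') hI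
  rw [one_div_one_div] at hN₁
  set Λ := Real.log (2 + d + T)
  have hΛ3 : Λ ≤ Λ ^ 3 := le_self_pow₀ hΛ (by norm_num)
  have hΛ1 : 1 ≤ Λ ^ 3 := hΛ.trans hΛ3
  have hregret2 : ∀ (θ : Param d) a, ENNReal.ofReal (instantRegret f θ a) ≤ 2 := fun θ a => by
    rw [← ENNReal.ofReal_ofNat]
    exact ENNReal.ofReal_le_ofReal (hf.instantRegret_le_two θ a)
  have hTδ : (T : ℝ≥0∞) * 2 * ENNReal.ofReal (1 / T) = ENNReal.ofReal 2 := by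
    rw [← ENNReal.ofReal_natCast, ← ENNReal.ofReal_ofNat, ← ENNReal.ofReal_mul (by positivity),
      ← ENNReal.ofReal_mul (by positivity)]
    congr 1
    field_simp
  have hfinal : ∀ {n₁ : ℕ} {R : ℝ}, (n₁ : ℝ) ≤ C₁ * Λ ^ 3 * (I + d ^ 2) →
      0 ≤ R → R ≤ (C₂ + 4) * Λ ^ 3 * D →
      (n₁ : ℝ≥0∞) * 2 + (ENNReal.ofReal R + ENNReal.ofReal 2) ≤
        ENNReal.ofReal ((2 * C₁ + C₂ + 6) * Λ ^ 3 * (I + D)) := by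
    intro n₁ R hn₁ hR0 hR
    rw [← ENNReal.ofReal_natCast, ← ENNReal.ofReal_ofNat, ← ENNReal.ofReal_mul (by positivity),
      ← ENNReal.ofReal_add hR0 (by positivity), ← ENNReal.ofReal_add (by positivity) (by positivity)]
    refine ENNReal.ofReal_le_ofReal ?_
    have h1 : C₁ * Λ ^ 3 * (I + d ^ 2) ≤ C₁ * Λ ^ 3 * (I + D) := by gcongr
    have h2 : (C₂ + 4) * Λ ^ 3 * D ≤ (C₂ + 4) * Λ ^ 3 * (I + D) := by
      gcongr
      linarith
    have h3 : 1 * 1 ≤ Λ ^ 3 * (I + D) := by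
      gcongr
      linarith
    linarith
  -- At this accuracy the learning rounds (up to logarithms) and the commitment afterwards each cost
  -- order `D`. If it exceeds `1/2`, then `T Cf ≤ 2 D`, and committing to the burn-in action is
  -- already good enough.
  by_cases hε : d / (cf * √T) ≤ 1 / 2
  · have hε0 : 0 < d / (cf * √T) := by positivity
    obtain ⟨N₂, hN₂⟩ := hlearn d f cf Cf (1 / T) (d / (cf * √T)) hd hf hl (by positivity)
      (by rw [div_le_one (by positivity)]; exact hT') hε0 hε
    rw [one_div_one_div] at hN₂
    set N : ℝ := max (max N₁ N₂) 1
    have hN : 0 < N := lt_of_lt_of_le one_pos (le_max_right _ _)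
    obtain ⟨p, n₁, hp, hn₁, hperr⟩ := hN₁ N hN ((le_max_left _ _).trans (le_max_left _ _))
    obtain ⟨q, n₂, hq, hn₂, hqerr⟩ := hN₂ N hN ((le_max_right _ _).trans (le_max_left _ _))
    have hn₂' : n₂ * Cf ≤ C₂ * Λ * D := by
      have h1 : C₂ * Λ * (d ^ 2 / (cf ^ 2 * (d / (cf * √T)))) * Cf = C₂ * Λ * D := by
        rw [hD]
        field_simp
      rw [← h1]
      gcongr
    have hTD : T * (Cf * (d / (cf * √T))) = D := by
      have h1 : √(T : ℝ) * √T * (Cf * (d / (cf * √T))) = D := by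
        rw [hD]
        field_simp
      rwa [hsT2] at h1
    refine (minimaxRegret_le (N := N) hf.measurable_meanReward hf.instantRegret_nonneg
      (fun u : Param d => toAction (u : Vec d)) (p.bind q) T
      (b := (n₁ : ℝ≥0∞) * 2 + (ENNReal.ofReal (n₂ * Cf + D + 2) + ENNReal.ofReal 2)) fun θ => ?_).trans
      (hfinal hn₁ (by positivity) ?_)
    · refine (cost_bind_le (B := 2) (fun a _ => hregret2 θ a) hp q T).trans
        (add_le_add le_rfl ?_)
      refine (wp_le_add_err (b := ENNReal.ofReal (n₂ * Cf + D + 2)) _ ?_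
        (fun a => cost_le_mul (hregret2 θ) T (q a))).trans
        (add_le_add le_rfl ((mul_le_mul' le_rfl (hperr θ)).trans_eq hTδ))
      rintro a ⟨ha, ϑ, hϑ, hϑa⟩
      obtain ⟨hw, herr⟩ := hqerr θ a ϑ hϑ ha hϑa
      -- Splits the learning rounds, of regret at most `Cf` each, from the commitment to the
      -- estimate.
      rw [← bind_ret_right (q a)]
      refine (cost_bind_le (B := ENNReal.ofReal Cf)
        (fun a ha => ENNReal.ofReal_le_ofReal ha) hw .ret T).trans ?_
      rw [ENNReal.ofReal_add (by positivity) (by norm_num),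
        ENNReal.ofReal_add (by positivity) (by positivity), add_assoc,
        ENNReal.ofReal_mul (by positivity), ENNReal.ofReal_natCast]
      refine add_le_add le_rfl ?_
      refine (wp_le_add_err (b := ENNReal.ofReal D) _ (fun u hu => ?_)
        (fun u => cost_le_mul (hregret2 θ) T _)).trans
        (add_le_add le_rfl ((mul_le_mul' le_rfl herr).trans_eq hTδ))
      rw [cost_ret, ← ENNReal.ofReal_natCast, ← ENNReal.ofReal_mul (by positivity), ← hTD]
      refine ENNReal.ofReal_le_ofReal ?_
      rw [real_inner_comm] at hu
      gcongr
      refine (instantRegret_le_mul hf hl hϑ (norm_param u).le (by linarith)).trans ?_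
      gcongr
    · have h1 : C₂ * Λ * D ≤ C₂ * Λ ^ 3 * D := by gcongr
      have h2 : 1 * D ≤ Λ ^ 3 * D := by gcongr
      linarith
  · push Not at hε
    set N : ℝ := max N₁ 1
    have hN : 0 < N := lt_of_lt_of_le one_pos (le_max_right _ _)
    obtain ⟨p, n₁, hp, hn₁, hperr⟩ := hN₁ N hN (le_max_left _ _)
    have hTD : T * Cf ≤ 2 * D := by
      have h1 : √(T : ℝ) * cf ≤ 2 * d := by
        rw [lt_div_iff₀ (by positivity)] at hε
        linarith
      have h2 : 2 * D = Cf / cf * √T * (2 * d) := by rw [hD]; ring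
      have h3 : T * Cf = Cf / cf * √T * (√T * cf) := by
        rw [← mul_assoc (Cf / cf * √(T : ℝ)), mul_assoc (Cf / cf), hsT2]
        field_simp
      rw [h2, h3]
      gcongr
    refine (minimaxRegret_le (N := N) hf.measurable_meanReward hf.instantRegret_nonneg
      toAction (p.bind .ret) T
      (b := (n₁ : ℝ≥0∞) * 2 + (ENNReal.ofReal (2 * D) + ENNReal.ofReal 2)) fun θ => ?_).trans
      (hfinal hn₁ (by positivity) ?_)
    · refine (cost_bind_le (B := 2) (fun a _ => hregret2 θ a) hp .ret T).trans
        (add_le_add le_rfl ?_)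
      refine (wp_le_add_err (b := ENNReal.ofReal (2 * D)) _ ?_
        (fun a => cost_le_mul (hregret2 θ) T _)).trans
        (add_le_add le_rfl ((mul_le_mul' le_rfl (hperr θ)).trans_eq hTδ))
      rintro a ⟨ha, ϑ, hϑ, hϑa⟩
      rw [cost_ret, ← ENNReal.ofReal_natCast, ← ENNReal.ofReal_mul (by positivity)]
      refine ENNReal.ofReal_le_ofReal (le_trans ?_ hTD)
      gcongr
      refine (instantRegret_le_mul hf hl hϑ ha.le (by linarith)).trans ?_
      nlinarith
    · have h2 : 1 * D ≤ Λ ^ 3 * D := by gcongr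
      have h3 : 0 ≤ C₂ * Λ ^ 3 * D := by positivity
      linarith

end RidgeBandit

theorem corollary1p7 :
    ∃ c K : ℝ, ∃ p : ℕ, 0 < c ∧ 0 < K ∧
      ∀ (d : ℕ) (f : ℝ → ℝ) (cf Cf : ℝ), 1 ≤ d →
        RidgeBandit.BurnInRegular f → RidgeBandit.LearningRegular f cf Cf →
        (∀ ε : ℝ, 0 < ε → ε < 1 / 2 →
          RidgeBandit.sampleComplexity f d ε ≤
            ENNReal.ofReal (K * Real.log (2 + d + 1 / ε) ^ p) *
              (RidgeBandit.burnInIntegral f d c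
                + ENNReal.ofReal ((d : ℝ) ^ 2 / (cf ^ 2 * ε)))) ∧
        (∀ T : ℕ,
          RidgeBandit.minimaxRegret f d T ≤
            ENNReal.ofReal (K * Real.log (2 + d + T) ^ p) *
              min (RidgeBandit.burnInIntegral f d c
                  + ENNReal.ofReal (Cf / cf * d * Real.sqrt T))
                (T : ℝ≥0∞)) := by
  obtain ⟨K₁, hK₁, hcomplexity⟩ := RidgeBandit.sampleComplexity_le
  obtain ⟨K₂, hK₂, hregret⟩ := RidgeBandit.minimaxRegret_le_of_lt
  refine ⟨3 / 256, K₁ + K₂ + 2, 3, by norm_num, by positivity,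
    fun d f cf Cf hd hf hl => ⟨fun ε hε0 hε1 => ?_, fun T => ?_⟩⟩
  · refine (hcomplexity d f cf Cf ε hd hf hl hε0 hε1).trans ?_
    have : 0 ≤ Real.log (2 + d + 1 / ε) := Real.log_nonneg (by
      have : 0 ≤ 1 / ε := by positivity
      have : (0 : ℝ) ≤ d := by positivity
      linarith)
    gcongr
    linarith
  · have hd' : (1 : ℝ) ≤ d := by exact_mod_cast hd
    have hCf := hl.pos.trans_le hl.le
    have hcf := hl.pos
    -- When `T` attains the minimum, the trivial regret bound `2T` suffices; otherwise the integral
    -- is finite and `D < T`.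
    rcases le_or_gt (T : ℝ≥0∞) (RidgeBandit.burnInIntegral f d (3 / 256)
        + ENNReal.ofReal (Cf / cf * d * Real.sqrt T)) with h | h
    · rw [min_eq_right h, mul_comm]
      refine (RidgeBandit.minimaxRegret_le_two_mul hf T).trans ?_
      rcases Nat.eq_zero_or_pos T with rfl | hT
      · simp
      · have hT' : (1 : ℝ) ≤ T := by exact_mod_cast hT
        have hΛ : 1 ≤ Real.log (2 + d + T) :=
          RidgeBandit.one_le_log_of_four_le (by linarith)
        have hΛ3 : 1 ≤ Real.log (2 + d + T) ^ 3 := one_le_pow₀ hΛ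
        gcongr
        rw [← ENNReal.ofReal_ofNat]
        refine ENNReal.ofReal_le_ofReal ?_
        nlinarith
    · have hI : RidgeBandit.burnInIntegral f d (3 / 256) ≠ ⊤ := by
        intro hI
        rw [hI, top_add] at h
        exact not_top_lt h
      have hDT : Cf / cf * d * Real.sqrt T < T := by
        have h1 := lt_of_le_of_lt le_add_self h
        rw [← ENNReal.ofReal_natCast] at h1
        exact (ENNReal.ofReal_lt_ofReal_iff_of_nonneg (by positivity)).1 h1
      have hΛ : 0 ≤ Real.log (2 + d + T) := Real.log_nonneg (by
        have : (0 : ℝ) ≤ T := by positivity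
        linarith)
      rw [min_eq_left h.le]
      refine (hregret d f cf Cf T hd hf hl hI hDT).trans ?_
      rw [ENNReal.ofReal_mul (by positivity),
        ENNReal.ofReal_add ENNReal.toReal_nonneg (by positivity), ENNReal.ofReal_toReal hI]
      gcongr
      linarith
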